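/- A hypergraph $G=(V,E,i)$ consists of finite sets $V=V(G)$ (vertices) and $E=E(G)$ (edges) and a map $i=i_G:E\to 2^V$ with $|i(e)|\ge 2$ for all $e\in E$ (parallel edges are allowed). The degree $d_G(v)$ of a vertex $v$ is the number of edges $e$ with $v\in i(e)$, and $\Delta(G)$ is the maximum degree ($\Delta(G)=0$ if $V=\varnothing$). $G$ is connected if any two vertices are joined by a hyperpath, that is, a sequence $(v_1,e_1,v_2,\dots,e_q,v_{q+1})$, $q\ge 0$, of distinct vertices $v_j$ and distinct edges $e_j$ with $\{v_j,v_{j+1}\}\subseteq i(e_j)$ for $1\le j\le q$. A vertex set is independent if it contains no set $i(e)$ with $e\in E$. A matching is a set $M$ of edges such that each vertex is incident to at most one edge of $M$. A cover of $G$ is a pair $(X,H)$ of a hypergraph $H$ and a map assigning to each $v\in V(G)$ a set $X_v\subseteq V(H)$ such that the sets $X_v$ are pairwise disjoint, independent in $H$, and have union $V(H)$, and such that for each $e\in E(G)$ there is a (possibly empty) matching $M_e$ of $H$, each of whose edges $\tilde e$ satisfies $i_H(\tilde e)\subseteq\bigcup_{v\in i_G(e)}X_v$ and $|i_H(\tilde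 e)\cap X_v|=1$ for all $v\in i_G(e)$, with $E(H)=\bigcup_{e\in E(G)}M_e$. The hypergraph $G$ is DP-$k$-colorable if for every cover $(X,H)$ of $G$ with $|X_v|\ge k$ for all $v\in V(G)$ there is an independent set $T$ of $H$ with $|T\cap X_v|=1$ for all $v\in V(G)$. The DP-chromatic number $\chi_{\mathrm{DP}}(G)$ is the least integer $k\ge 0$ such that $G$ is DP-$k$-colorable. For a simple graph $S$ and $t\ge 1$, let $tS$ denote the hypergraph obtained from $S$ by replacing each edge with $t$ parallel edges. Let $K_n$ be the complete graph and $C_n$ the cycle on $n$ vertices. A DP-hyperbrick is a hypergraph $G$ that is (up to isomorphism) $tK_n$ for some $t,n\ge 1$, or $tC_n$ for some $t\ge 1$, $n\ge 3$, or that has exactly one edge $e$, with $i_G(e)=V(G)$. **Theorem.** Let $G$ be a connected hypergraph. Then $\chi_{\mathrm{DP}}(G)\le\Delta(G)+1$, and equality holds if and only if $G$ is a DP-hyperbrick. -/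

import Mathlib

universe u v u' v'

/-- A hypergraph `(V, E, i)` with vertex set `V`, edge set `E` and incidence function `i`, in which
parallel edges are allowed and every edge has at least two vertices. Finiteness of `V` and `E` is
expressed by `Fintype` instances where such hypergraphs are used. (Mathlib's `Hypergraph` is given by
a set of vertex sets, and so has no parallel edges.) -/
structure MultiHypergraph (V : Type u) (E : Type v) where
  /-- The set of vertices incident to an edge. -/
  inc : E → Finset V
  two_le_card : ∀ e, 2 ≤ (inc e).card

namespace MultiHypergraph

variable {V : Type u} {E : Type v} {V' : Type u'} {E' : Type v'}

/-- The degree of a vertex: the number of edges incident to it. -/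
def degree [DecidableEq V] [Fintype E] (G : MultiHypergraph V E) (x : V) : ℕ :=
  (Finset.univ.filter fun e => x ∈ G.inc e).card

/-- The maximum degree; it is `0` for the empty hypergraph. -/
def maxDegree [DecidableEq V] [Fintype V] [Fintype E] (G : MultiHypergraph V E) : ℕ :=
  Finset.univ.sup G.degree

/-- There is a hyperpath `(p₀, s₀, p₁, s₁, …, s_{q-1}, p_q)` from `x` to `y`, with distinct vertices
`pᵢ` and distinct edges `sᵢ` such that `{pᵢ, pᵢ₊₁} ⊆ i(sᵢ)`. -/
def HasHyperpath (G : MultiHypergraph V E) (x y : V) : Prop :=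
  ∃ (q : ℕ) (p : Fin (q + 1) → V) (s : Fin q → E),
    Function.Injective p ∧ Function.Injective s ∧ p 0 = x ∧ p (Fin.last q) = y ∧
      ∀ i : Fin q, p i.castSucc ∈ G.inc (s i) ∧ p i.succ ∈ G.inc (s i)

/-- A hypergraph is connected if any two of its vertices are joined by a hyperpath. -/
def Connected (G : MultiHypergraph V E) : Prop :=
  ∀ x y : V, G.HasHyperpath x y

/-- A vertex set is independent if it contains no edge. -/
def IsIndependent (G : MultiHypergraph V E) (S : Finset V) : Prop :=
  ∀ e, ¬ G.inc e ⊆ S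

/-- An edge set is a matching if each vertex lies in at most one of its edges. -/
def IsMatching (G : MultiHypergraph V E) (M : Set E) : Prop :=
  ∀ e ∈ M, ∀ e' ∈ M, ∀ x, x ∈ G.inc e → x ∈ G.inc e' → e = e'

/-- `(X, H)` is a cover of `G`: the sets `X x`, for `x` a vertex of `G`, are pairwise disjoint
independent sets of `H` whose union is the vertex set of `H`, and the edge set of `H` is the union
of matchings `M e`, for `e` an edge of `G`, such that each edge of `M e` is contained in the union
of the sets `X x` with `x` incident to `e` and has exactly one vertex in each of these sets. -/
structure IsCover {W : Type u'} {F : Type v'} [DecidableEq W]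
    (G : MultiHypergraph V E) (X : V → Finset W) (H : MultiHypergraph W F) : Prop where
  disjoint : ∀ x y : V, x ≠ y → Disjoint (X x) (X y)
  union : ∀ w : W, ∃ x : V, w ∈ X x
  independent : ∀ x : V, H.IsIndependent (X x)
  matchings : ∃ M : E → Set F,
    (∀ e, H.IsMatching (M e)) ∧
    (∀ e, ∀ f ∈ M e, H.inc f ⊆ (G.inc e).biUnion X ∧
      ∀ x ∈ G.inc e, (H.inc f ∩ X x).card = 1) ∧
    (⋃ e, M e) = Set.univ

/-- There is an independent transversal: an independent set `T` of `H` that has exactly one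
vertex in each of the sets `X x`. -/
def HasIndependentTransversal {W : Type u'} {F : Type v'} [DecidableEq W]
    (X : V → Finset W) (H : MultiHypergraph W F) : Prop :=
  ∃ T : Finset W, (∀ x : V, (T ∩ X x).card = 1) ∧ H.IsIndependent T

/-- `G` is DP-`f`-colorable: every cover `(X, H)` with `|X x| ≥ f x` for all vertices `x` has an
independent transversal. As `H` is finite, it is enough to let its vertex set and its edge set range
over the finite types in the lowest universe. -/
def DPColorable (G : MultiHypergraph V E) (f : V → ℕ) : Prop :=
  ∀ (W F : Type) [Fintype W] [DecidableEq W] [Fintype F]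
    (X : V → Finset W) (H : MultiHypergraph W F),
    G.IsCover X H → (∀ x, f x ≤ (X x).card) → HasIndependentTransversal X H

/-- The DP-chromatic number: the least `k` such that `G` is DP-`k`-colorable (it would be `⊤` if
there were no such `k`). -/
noncomputable def dpChromaticNumber (G : MultiHypergraph V E) : ℕ∞ :=
  ⨅ k ∈ {k : ℕ | G.DPColorable fun _ => k}, (k : ℕ∞)

/-- An isomorphism of hypergraphs. -/
structure Iso (G : MultiHypergraph V E) (G' : MultiHypergraph V' E') where
  vertexEquiv : V ≃ V'
  edgeEquiv : E ≃ E'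
  inc_edgeEquiv : ∀ e, G'.inc (edgeEquiv e) = (G.inc e).map vertexEquiv.toEmbedding

/-- For a simple graph `S`, the hypergraph `tS` obtained by replacing each edge of `S` with `t`
parallel edges. -/
def multiple [DecidableEq V] (t : ℕ) (S : SimpleGraph V) :
    MultiHypergraph V (S.edgeSet × Fin t) where
  inc e := (e.1 : Sym2 V).toFinset
  two_le_card e :=
    (Sym2.card_toFinset_of_not_isDiag _ (S.not_isDiag_of_mem_edgeSet e.1.2)).ge

/-- `G = tKₙ` for some `t, n ≥ 1`, or `G = tCₙ` for some `t ≥ 1`, `n ≥ 3`. -/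
def IsDPBrick (G : MultiHypergraph V E) : Prop :=
  (∃ t n : ℕ, 1 ≤ t ∧ 1 ≤ n ∧ Nonempty (G.Iso (multiple t (SimpleGraph.completeGraph (Fin n))))) ∨
  (∃ t n : ℕ, 1 ≤ t ∧ 3 ≤ n ∧ Nonempty (G.Iso (multiple t (SimpleGraph.cycleGraph n))))

/-- `G = <e>` for some edge `e`: the only edge of `G` is `e`, and `e` is incident to all vertices. -/
def IsSingleEdge (G : MultiHypergraph V E) : Prop :=
  ∃ e : E, (∀ e' : E, e' = e) ∧ ∀ x : V, x ∈ G.inc e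

/-- A DP-hyperbrick is a DP-brick or a single edge. -/
def IsDPHyperbrick (G : MultiHypergraph V E) : Prop :=
  G.IsDPBrick ∨ G.IsSingleEdge

end MultiHypergraph

/-! A cover is encoded by forbidden patterns on the edges: two patterns of an edge that agree at one
of its vertices agree on the whole edge. Call the data bad (`IsBad`) if every list is at least as
large as the degree and no proper coloring exists. In the connected case, all vertices but a chosen
`w` can be colored greedily towards `w` (`Proper.greedy`). Failure at `w` then means that the edges
at `w` forbid pairwise different colors which exhaust the list (`Proper.forbidden`). So every list
has size exactly the degree. This excludes lists of size `Δ + 1`, and with lists of size at least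
`Δ` it makes the hypergraph regular.

For the regular case, the same rigidity holds after precoloring any set with connected complement
(`IsBad.exists_extension`): a precoloring that makes two edges at a vertex forbid the same color is
a contradiction. Suitable precolorings exclude cut vertices (`IsBad.connOn_compl_singleton`),
exclude edges with more than two vertices unless all degrees are `1` (`IsBad.card_inc`), and show
that nonadjacent vertices with a common neighbour separate (`IsBad.not_connOn_compl_pair`). Pure
graph theory (`complete_or_two_neighbors`) leaves complete graphs and cycles, and counting
conflicting colors makes the multiplicity constant.

Conversely, a brick has a cover with lists of size `Δ` and no transversal. For `tS`, the `t`
parallel edges can join two blocks of `t` colors completely, which reduces the claim to `n - 1`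
colors on `K_n` or two colors on a cycle with one twisted edge (`DPColorable.exists_coloring`). -/

namespace SimpleGraph

/-! ### Connectedness in terms of closed sets -/

variable {V : Type u} (S : SimpleGraph V)

/-- `B` is a subset of `A` that is closed under adjacency within `A`. -/
def ClosedIn (A B : Finset V) : Prop :=
  B ⊆ A ∧ ∀ x ∈ B, ∀ y ∈ A, S.Adj x y → y ∈ B

/-- The subgraph induced by `A` is (pre)connected: `A` is its only nonempty closed subset. -/
def ConnOn (A : Finset V) : Prop :=
  ∀ B, S.ClosedIn A B → B.Nonempty → B = A

variable {S}

variable (S) in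
open Classical in
/-- The vertex set of the component of `w` in the subgraph induced by `A`. -/
noncomputable def comp (A : Finset V) (w : V) : Finset V :=
  A.filter fun x => ∀ B, S.ClosedIn A B → w ∈ B → x ∈ B

theorem mem_comp_self {A : Finset V} {w : V} (hw : w ∈ A) : w ∈ S.comp A w := by
  simp only [comp, Finset.mem_filter]
  exact ⟨hw, fun B _ h => h⟩

theorem comp_subset (A : Finset V) (w : V) : S.comp A w ⊆ A :=
  fun _ hx => by
    simp only [comp, Finset.mem_filter] at hx
    exact hx.1

theorem comp_minimal {A B : Finset V} {w : V} (hB : S.ClosedIn A B) (hw : w ∈ B) :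
    S.comp A w ⊆ B := fun x hx => by
  simp only [comp, Finset.mem_filter] at hx
  exact hx.2 B hB hw

theorem closedIn_comp (A : Finset V) (w : V) : S.ClosedIn A (S.comp A w) := by
  refine ⟨comp_subset A w, fun x hx y hy hxy => ?_⟩
  simp only [comp, Finset.mem_filter] at hx ⊢
  exact ⟨hy, fun B hB hw => hB.2 x (hx.2 B hB hw) y hy hxy⟩

variable [DecidableEq V]

theorem ClosedIn.sdiff {A B : Finset V} (h : S.ClosedIn A B) : S.ClosedIn A (A \ B) := by
  refine ⟨Finset.sdiff_subset, fun x hx y hy hxy => ?_⟩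
  rw [Finset.mem_sdiff] at hx ⊢
  exact ⟨hy, fun hyB => hx.2 (h.2 y hyB x hx.1 hxy.symm)⟩

/-- To prove connectedness it is enough to consider the closed sets that avoid a given vertex. -/
theorem connOn_of {A : Finset V} (v : V)
    (h : ∀ B, S.ClosedIn A B → v ∉ B → B = ∅) : S.ConnOn A := by
  intro B hB hne
  by_cases hvB : v ∈ B
  · have := h _ hB.sdiff (by simp [hvB])
    exact Finset.Subset.antisymm hB.1 (Finset.sdiff_eq_empty_iff_subset.1 this)
  · exact absurd (h B hB hvB) hne.ne_empty

theorem ConnOn.eq_empty {A B : Finset V} {v : V} (h : S.ConnOn A) (hB : S.ClosedIn A B)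
    (hv : v ∈ A) (hvB : v ∉ B) : B = ∅ := by
  by_contra hne
  exact hvB (h B hB (Finset.nonempty_iff_ne_empty.2 hne) ▸ hv)

theorem ConnOn.subset_of_mem {A C Q : Finset V} {q : V} (hQ : S.ConnOn Q) (hQA : Q ⊆ A)
    (hC : S.ClosedIn A C) (hqQ : q ∈ Q) (hqC : q ∈ C) : Q ⊆ C := by
  have : Q ∩ C = Q := by
    refine hQ _ ⟨Finset.inter_subset_left, fun x hx y hy hxy => ?_⟩ ⟨q, by simp [hqQ, hqC]⟩
    rw [Finset.mem_inter] at hx ⊢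
    exact ⟨hy, hC.2 x hx.2 y (hQA hy) hxy⟩
  exact Finset.inter_eq_left.1 this

theorem connOn_comp {A : Finset V} {w : V} (hw : w ∈ A) : S.ConnOn (S.comp A w) := by
  refine connOn_of w fun B hB hwB => ?_
  have h1 : S.ClosedIn A (S.comp A w \ B) := by
    refine ⟨Finset.sdiff_subset.trans (comp_subset A w), fun x hx y hy hxy => ?_⟩
    rw [Finset.mem_sdiff] at hx ⊢
    have hyc := (closedIn_comp A w).2 x hx.1 y hy hxy
    exact ⟨hyc, fun hyB => hx.2 (hB.2 y hyB x hx.1 hxy.symm)⟩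
  have h2 := comp_minimal h1 (Finset.mem_sdiff.2 ⟨mem_comp_self hw, hwB⟩)
  refine Finset.eq_empty_of_forall_notMem fun x hx => ?_
  exact (Finset.mem_sdiff.1 (h2 (hB.1 hx))).2 hx

/-! ### Separating pairs, complete graphs and cycles -/

variable [Fintype V]

/-- A connected graph that is not complete contains an induced path with three vertices. -/
theorem exists_induced_path (h1 : S.ConnOn Finset.univ) {u v : V} (huv : u ≠ v)
    (hadj : ¬ S.Adj u v) : ∃ x y z, x ≠ z ∧ ¬ S.Adj x z ∧ S.Adj y x ∧ S.Adj y z := by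
  classical
  by_contra! hcon
  have hcl : S.ClosedIn Finset.univ (Finset.univ.filter fun x => x = u ∨ S.Adj u x) := by
    refine ⟨Finset.subset_univ _, fun x hx y _ hxy => ?_⟩
    simp only [Finset.mem_filter, Finset.mem_univ, true_and] at hx ⊢
    rcases hx with rfl | hx
    · exact Or.inr hxy
    · by_contra! hy
      exact hcon u x y hy.1.symm hy.2 hx.symm hxy
  have := h1 _ hcl ⟨u, by simp⟩
  have hv : v ∈ (Finset.univ.filter fun x => x = u ∨ S.Adj u x) := by
    rw [this]
    exact Finset.mem_univ v
  simp only [Finset.mem_filter, Finset.mem_univ, true_and] at hv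
  rcases hv with rfl | hv
  · exact huv rfl
  · exact hadj hv

/-- In a graph without cut vertices, each vertex of a separating pair has a neighbour in each
fragment. -/
theorem exists_adj_of_closedIn_pair (h2 : ∀ x, S.ConnOn {x}ᶜ) {x y : V} (hxy : x ≠ y)
    {C : Finset V} (hC : S.ClosedIn {x, y}ᶜ C) (hne : C.Nonempty) : ∃ c ∈ C, S.Adj c x := by
  by_contra! hcon
  have hcl : S.ClosedIn {y}ᶜ C := by
    refine ⟨fun c hc => ?_, fun a ha b hb hab => ?_⟩
    · have := hC.1 hc
      simp only [Finset.mem_compl, Finset.mem_insert, Finset.mem_singleton] at this ⊢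
      tauto
    · refine hC.2 a ha b ?_ hab
      simp only [Finset.mem_compl, Finset.mem_insert, Finset.mem_singleton] at hb ⊢
      rintro (rfl | rfl)
      · exact hcon a ha hab
      · exact hb rfl
  have hx : x ∈ C := by
    rw [h2 y C hcl hne]
    simpa using hxy
  simpa using hC.1 hx

/-- If no fragment of a separating pair is smaller than the fragment `K` of `{x, y}`, then `x` and a
vertex of `K` do not form a separating pair. -/
theorem connOn_compl_pair_of_minimal (h2 : ∀ x, S.ConnOn {x}ᶜ) {x y : V} (hxy : x ≠ y)
    {K : Finset V} (hK : S.ClosedIn {x, y}ᶜ K)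
    (hmin : ∀ x' y' K', x' ≠ y' → S.ClosedIn {x', y'}ᶜ K' → K'.Nonempty → K' ≠ {x', y'}ᶜ →
      K.card ≤ K'.card) {z : V} (hz : z ∈ K) : S.ConnOn {x, z}ᶜ := by
  have hzA := hK.1 hz
  simp only [Finset.mem_compl, Finset.mem_insert, Finset.mem_singleton, not_or] at hzA
  have hyA : y ∈ ({x, z}ᶜ : Finset V) := by
    simp only [Finset.mem_compl, Finset.mem_insert, Finset.mem_singleton, not_or]
    exact ⟨hxy.symm, fun h => hzA.2 h.symm⟩
  refine connOn_of y fun B hB hyB => ?_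
  have hBA : ∀ b ∈ B, b ≠ x ∧ b ≠ z := fun b hb => by
    have := hB.1 hb
    simpa only [Finset.mem_compl, Finset.mem_insert, Finset.mem_singleton, not_or] using this
  -- Otherwise `B ∩ K` is a fragment of `{x, z}` that misses `y`, and it is smaller than `K` because
  -- it misses `z`.
  have hBK : B ∩ K = ∅ := by
    by_contra hne
    have hcl : S.ClosedIn {x, z}ᶜ (B ∩ K) := by
      refine ⟨Finset.inter_subset_left.trans hB.1, fun a ha b hb hab => ?_⟩
      rw [Finset.mem_inter] at ha ⊢
      have hbB := hB.2 a ha.1 b hb hab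
      refine ⟨hbB, hK.2 a ha.2 b ?_ hab⟩
      simp only [Finset.mem_compl, Finset.mem_insert, Finset.mem_singleton, not_or]
      exact ⟨(hBA b hbB).1, fun h => hyB (h ▸ hbB)⟩
    have hle := hmin x z _ (Ne.symm hzA.1) hcl (Finset.nonempty_iff_ne_empty.2 hne)
      (fun h => hyB (Finset.mem_inter.1 (h ▸ hyA)).1)
    have hlt : (B ∩ K).card < K.card := by
      refine Finset.card_lt_card ⟨Finset.inter_subset_right, fun h => ?_⟩
      exact (hBA z (Finset.mem_inter.1 (h hz)).1).2 rfl
    omega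
  have hcl : S.ClosedIn {x}ᶜ B := by
    refine ⟨fun b hb => by simpa using (hBA b hb).1, fun a ha b hb hab => ?_⟩
    refine hB.2 a ha b ?_ hab
    simp only [Finset.mem_compl, Finset.mem_insert, Finset.mem_singleton, not_or] at hb ⊢
    refine ⟨hb, ?_⟩
    rintro rfl
    have haK : a ∈ K := by
      refine hK.2 b hz a ?_ hab.symm
      simp only [Finset.mem_compl, Finset.mem_insert, Finset.mem_singleton, not_or]
      exact ⟨(hBA a ha).1, fun h => hyB (h ▸ ha)⟩
    have : a ∈ B ∩ K := Finset.mem_inter.2 ⟨ha, haK⟩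
    simp [hBK] at this
  exact (h2 x).eq_empty hcl (by simpa using hxy.symm) hyB

/-- Let `K` be a fragment of the separating pair `{x, y}` and let `z ∈ K`, `q ∉ K`. Then each
fragment of `{z, q}` contains `x` or `y`. -/
theorem eq_empty_of_closedIn_cross (h2 : ∀ x, S.ConnOn {x}ᶜ) {x y : V}
    {K : Finset V} (hK : S.ClosedIn {x, y}ᶜ K) {z q : V} (hz : z ∈ K)
    (hq : q ∈ ({x, y}ᶜ : Finset V) \ K) {B : Finset V} (hB : S.ClosedIn {z, q}ᶜ B) (hxB : x ∉ B)
    (hyB : y ∉ B) : B = ∅ := by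
  have hzA := hK.1 hz
  have hqA := (Finset.mem_sdiff.1 hq).1
  have hO := hK.sdiff
  simp only [Finset.mem_compl, Finset.mem_insert, Finset.mem_singleton, not_or] at hzA hqA
  have hx : x ∈ ({z, q}ᶜ : Finset V) := by
    simp only [Finset.mem_compl, Finset.mem_insert, Finset.mem_singleton, not_or]
    exact ⟨fun h => hzA.1 h.symm, fun h => hqA.1 h.symm⟩
  have hy : y ∈ ({z, q}ᶜ : Finset V) := by
    simp only [Finset.mem_compl, Finset.mem_insert, Finset.mem_singleton, not_or]
    exact ⟨fun h => hzA.2 h.symm, fun h => hqA.2 h.symm⟩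
  -- `C` will be either side of `{x, y}`, with `p'` the one of `z`, `q` inside `C` and `p` the
  -- other. As `B` misses `x` and `y`, none of its vertices is adjacent to them, so `B ∩ C` can only
  -- be left through `p'`, which is not a cut vertex.
  have key : ∀ (C : Finset V) (p p' : V), S.ClosedIn {x, y}ᶜ C → p ∉ C →
      ({z, q}ᶜ : Finset V) = {p', p}ᶜ → p ≠ x → B ∩ C = ∅ := by
    intro C p p' hC hp hpp hpx
    have hcl : S.ClosedIn {p'}ᶜ (B ∩ C) := by
      refine ⟨fun b hb => ?_, fun a ha b hb hab => ?_⟩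
      · have := hB.1 (Finset.mem_inter.1 hb).1
        rw [hpp] at this
        simp only [Finset.mem_compl, Finset.mem_insert, Finset.mem_singleton, not_or] at this ⊢
        exact this.1
      · rw [Finset.mem_inter] at ha ⊢
        have hbC : b ∈ C := by
          refine hC.2 a ha.2 b ?_ hab
          simp only [Finset.mem_compl, Finset.mem_insert, Finset.mem_singleton, not_or]
          exact ⟨fun h => hxB (hB.2 a ha.1 x hx (h ▸ hab)),
            fun h => hyB (hB.2 a ha.1 y hy (h ▸ hab))⟩
        refine ⟨hB.2 a ha.1 b ?_ hab, hbC⟩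
        rw [hpp]
        simp only [Finset.mem_compl, Finset.mem_insert, Finset.mem_singleton, not_or] at hb ⊢
        exact ⟨hb, fun h => hp (h ▸ hbC)⟩
    refine (h2 p').eq_empty hcl (v := x) ?_ (fun h => hxB (Finset.mem_inter.1 h).1)
    rw [hpp] at hx
    simp only [Finset.mem_compl, Finset.mem_insert, Finset.mem_singleton, not_or] at hx ⊢
    exact hx.1
  have hBK := key K q z hK (Finset.mem_sdiff.1 hq).2 rfl hqA.1
  have hBO := key _ z q hO (fun h => (Finset.mem_sdiff.1 h).2 hz) (by rw [Finset.pair_comm]) hzA.1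
  refine Finset.eq_empty_of_forall_notMem fun b hb => ?_
  by_cases hbK : b ∈ K
  · have : b ∈ B ∩ K := Finset.mem_inter.2 ⟨hb, hbK⟩
    simp [hBK] at this
  · refine Finset.notMem_empty b (hBO ▸ ?_)
    simp only [Finset.mem_inter, Finset.mem_sdiff, Finset.mem_compl, Finset.mem_insert,
      Finset.mem_singleton, not_or]
    exact ⟨hb, ⟨fun h => hxB (h ▸ hb), fun h => hyB (h ▸ hb)⟩, hbK⟩

/-- Suppose that no two nonadjacent vertices with a common neighbour can be removed without
disconnecting the graph. Then a vertex `z` with exactly two neighbours `x`, `y`, which are not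
adjacent, has only neighbours of the same kind. -/
theorem neighbor_of_degree_two (h2 : ∀ x, S.ConnOn {x}ᶜ)
    (h3 : ∀ u v w, u ≠ v → ¬ S.Adj u v → S.Adj w u → S.Adj w v → ¬ S.ConnOn {u, v}ᶜ)
    {x y z : V} (hxy : x ≠ y) (hadj : ¬ S.Adj x y) (hz : ∀ a, S.Adj z a ↔ a = x ∨ a = y) :
    ∃ q, q ≠ z ∧ ¬ S.Adj z q ∧ ∀ a, S.Adj x a ↔ a = z ∨ a = q := by
  have hzx : S.Adj z x := (hz x).2 (Or.inl rfl)
  have hzy : S.Adj z y := (hz y).2 (Or.inr rfl)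
  have hK : S.ClosedIn {x, y}ᶜ {z} := by
    refine ⟨fun a ha => ?_, fun a ha b hb hab => ?_⟩
    · rw [Finset.mem_singleton] at ha
      simp only [Finset.mem_compl, Finset.mem_insert, Finset.mem_singleton, not_or, ha]
      exact ⟨hzx.ne, hzy.ne⟩
    · rw [Finset.mem_singleton] at ha
      subst ha
      have := (hz b).1 hab
      simp only [Finset.mem_compl, Finset.mem_insert, Finset.mem_singleton] at hb
      exact absurd this hb
  have hqq : ∀ q q', S.Adj x q → S.Adj x q' → q ≠ z → q' ≠ z → q = q' := by
    intro q q' hq hq' hqz hqz'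
    by_contra hne
    have hqy : q ≠ y := fun h => hadj (h ▸ hq)
    have hqy' : q' ≠ y := fun h => hadj (h ▸ hq')
    -- `z` and `p` have the common neighbour `x`, so they separate; by the crossing lemma a fragment
    -- without `x` must contain `y`.
    have main : ∀ p, S.Adj x p → p ≠ z → ∃ B, S.ClosedIn {z, p}ᶜ B ∧ y ∈ B ∧ x ∉ B := by
      intro p hp hpz
      have hpy : p ≠ y := fun h => hadj (h ▸ hp)
      have hnadj : ¬ S.Adj z p := fun h => by
        rcases (hz p).1 h with rfl | rfl
        · exact hp.ne rfl
        · exact hpy rfl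
      have hn := h3 z p x (Ne.symm hpz) hnadj hzx.symm hp
      have hpO : p ∈ ({x, y}ᶜ : Finset V) \ {z} := by
        simp only [Finset.mem_sdiff, Finset.mem_compl, Finset.mem_insert, Finset.mem_singleton,
          not_or]
        exact ⟨⟨hp.ne.symm, hpy⟩, hpz⟩
      by_contra! hcon
      refine hn (connOn_of x fun B hB hxB => ?_)
      refine eq_empty_of_closedIn_cross h2 hK (Finset.mem_singleton_self z) hpO hB hxB ?_
      exact fun hy => hxB (hcon B hB hy)
    obtain ⟨C, hC, hyC, hxC⟩ := main q hq hqz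
    obtain ⟨C', hC', hyC', hxC'⟩ := main q' hq' hqz'
    have hxq : x ∈ ({z, q}ᶜ : Finset V) := by
      simp only [Finset.mem_compl, Finset.mem_insert, Finset.mem_singleton, not_or]
      exact ⟨hzx.ne.symm, hq.ne⟩
    have hxq' : x ∈ ({z, q'}ᶜ : Finset V) := by
      simp only [Finset.mem_compl, Finset.mem_insert, Finset.mem_singleton, not_or]
      exact ⟨hzx.ne.symm, hq'.ne⟩
    have hqC' : q ∉ C' := fun h => hxC' (hC'.2 q h x hxq' hq.symm)
    have hqC : q' ∉ C := fun h => hxC (hC.2 q' h x hxq hq'.symm)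
    -- Since `q ∉ C'` and `q' ∉ C`, deleting `z` alone already isolates `C ∩ C'`. It contains `y`
    -- but not `x`, so `z` would be a cut vertex.
    have hcl : S.ClosedIn {z}ᶜ (C ∩ C') := by
      refine ⟨fun a ha => ?_, fun a ha b hb hab => ?_⟩
      · have := hC.1 (Finset.mem_inter.1 ha).1
        simp only [Finset.mem_compl, Finset.mem_insert, Finset.mem_singleton, not_or] at this ⊢
        exact this.1
      · rw [Finset.mem_inter] at ha ⊢
        simp only [Finset.mem_compl, Finset.mem_singleton] at hb
        constructor
        · refine hC.2 a ha.1 b ?_ hab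
          simp only [Finset.mem_compl, Finset.mem_insert, Finset.mem_singleton, not_or]
          refine ⟨hb, ?_⟩
          rintro rfl
          refine hqC' (hC'.2 a ha.2 b ?_ hab)
          simp only [Finset.mem_compl, Finset.mem_insert, Finset.mem_singleton, not_or]
          exact ⟨hb, hne⟩
        · refine hC'.2 a ha.2 b ?_ hab
          simp only [Finset.mem_compl, Finset.mem_insert, Finset.mem_singleton, not_or]
          refine ⟨hb, ?_⟩
          rintro rfl
          refine hqC (hC.2 a ha.1 b ?_ hab)
          simp only [Finset.mem_compl, Finset.mem_insert, Finset.mem_singleton, not_or]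
          exact ⟨hb, Ne.symm hne⟩
    have := (h2 z).eq_empty hcl (v := x) (by simpa using hzx.ne.symm)
      (fun h => hxC (Finset.mem_inter.1 h).1)
    have hy : y ∈ C ∩ C' := Finset.mem_inter.2 ⟨hyC, hyC'⟩
    simp [this] at hy
  obtain ⟨q, hq, hqz⟩ : ∃ q, S.Adj x q ∧ q ≠ z := by
    by_contra! hcon
    have hcl : S.ClosedIn {z}ᶜ {x} := by
      refine ⟨fun a ha => ?_, fun a ha b hb hab => ?_⟩
      · rw [Finset.mem_singleton] at ha
        simpa [ha] using hzx.ne.symm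
      · rw [Finset.mem_singleton] at ha
        subst ha
        simp only [Finset.mem_compl, Finset.mem_singleton] at hb
        exact absurd (hcon b hab) hb
    have := (h2 z).eq_empty hcl (v := y) (by simpa using hzy.ne.symm) (by simpa using hxy.symm)
    simp at this
  refine ⟨q, hqz, fun h => ?_, fun a => ⟨fun ha => ?_, ?_⟩⟩
  · rcases (hz q).1 h with rfl | rfl
    · exact hq.ne rfl
    · exact hadj hq
  · by_cases haz : a = z
    · exact Or.inl haz
    · exact Or.inr (hqq a q ha hq haz hqz)
  · rintro (rfl | rfl)
    · exact hzx.symm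
    · exact hq

/-- A characterisation of complete graphs and cycles: graphs without cut vertices in which any two
nonadjacent vertices with a common neighbour form a separating pair. -/
theorem complete_or_two_neighbors (h1 : S.ConnOn Finset.univ) (h2 : ∀ x, S.ConnOn {x}ᶜ)
    (h3 : ∀ u v w, u ≠ v → ¬ S.Adj u v → S.Adj w u → S.Adj w v → ¬ S.ConnOn {u, v}ᶜ) :
    (∀ u v, u ≠ v → S.Adj u v) ∨
      ∀ z, ∃ x y, x ≠ y ∧ ¬ S.Adj x y ∧ ∀ a, S.Adj z a ↔ a = x ∨ a = y := by
  classical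
  by_contra! hcon
  obtain ⟨⟨u, v, huv, hadj⟩, z₀, hz₀⟩ := hcon
  obtain ⟨x', y', z', hne', hadj', hyx', hyz'⟩ := exists_induced_path h1 huv hadj
  have hsep := h3 x' z' y' hne' hadj' hyx' hyz'
  have hex : ∃ n, ∃ x y K, x ≠ y ∧ S.ClosedIn {x, y}ᶜ K ∧ K.Nonempty ∧ K ≠ {x, y}ᶜ ∧
      K.card = n := by
    unfold ConnOn at hsep
    push Not at hsep
    obtain ⟨B, hB, hBn, hBne⟩ := hsep
    exact ⟨_, x', z', B, hne', hB, hBn, hBne, rfl⟩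
  obtain ⟨x, y, K, hxy, hK, hKn, hK', hcard⟩ := Nat.find_spec hex
  have hmin : ∀ x' y' K', x' ≠ y' → S.ClosedIn {x', y'}ᶜ K' → K'.Nonempty → K' ≠ {x', y'}ᶜ →
      K.card ≤ K'.card := by
    intro a b C h₁ h₂ h₃ h₄
    rw [hcard]
    exact Nat.find_min' hex ⟨a, b, C, h₁, h₂, h₃, h₄, rfl⟩
  -- The neighbours of `x` in `K` form a closed set: a vertex `b` of `K` at distance two from `x`
  -- would separate together with `x`, against the minimality of `K`. By minimality again, this set
  -- is all of `K`.
  have hall : ∀ x y, x ≠ y → S.ClosedIn {x, y}ᶜ K → K ≠ {x, y}ᶜ → ∀ z ∈ K, S.Adj x z := by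
    intro x y hxy hK hK1
    have hcl : S.ClosedIn {x, y}ᶜ (K.filter fun z => S.Adj x z) := by
      refine ⟨(Finset.filter_subset _ _).trans hK.1, fun a ha b hb hab => ?_⟩
      rw [Finset.mem_filter] at ha ⊢
      have hbK := hK.2 a ha.1 b hb hab
      refine ⟨hbK, ?_⟩
      by_contra hxb
      refine h3 x b a ?_ hxb ha.2.symm hab (connOn_compl_pair_of_minimal h2 hxy hK hmin hbK)
      rintro rfl
      simp at hb
    obtain ⟨c, hc, hcx⟩ := exists_adj_of_closedIn_pair h2 hxy hK hKn
    have hcK : c ∈ K.filter fun z => S.Adj x z := Finset.mem_filter.2 ⟨hc, hcx.symm⟩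
    have hle := hmin x y _ hxy hcl ⟨c, hcK⟩ fun h =>
      hK1 (Finset.Subset.antisymm hK.1 (h ▸ Finset.filter_subset _ _))
    have := Finset.eq_of_subset_of_card_le (Finset.filter_subset _ _) hle
    intro z hz
    rw [← this] at hz
    exact (Finset.mem_filter.1 hz).2
  have hKyx : S.ClosedIn {y, x}ᶜ K := by rwa [Finset.pair_comm]
  have hx := hall x y hxy hK hK'
  have hy := hall y x hxy.symm hKyx (by rwa [Finset.pair_comm])
  obtain ⟨z, hz⟩ := hKn
  have hzA := hK.1 hz
  simp only [Finset.mem_compl, Finset.mem_insert, Finset.mem_singleton, not_or] at hzA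
  obtain ⟨q, hqO, hqx⟩ := exists_adj_of_closedIn_pair h2 hxy hK.sdiff
    (Finset.sdiff_nonempty.2 fun h => hK' (Finset.Subset.antisymm hK.1 h))
  have hqA := Finset.mem_sdiff.1 hqO
  have hzq : z ≠ q := fun h => hqA.2 (h ▸ hz)
  have hzq' : ¬ S.Adj z q := fun h => hqA.2 (hK.2 z hz q hqA.1 h)
  -- An edge `xy` or a second vertex `w` of `K` links `x` to `y` outside `{z, q}`. As every fragment
  -- of `{z, q}` contains `x` or `y`, this pair would not separate. Hence `K = {z}` and `x`, `y` are
  -- nonadjacent.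
  have hnot : ∀ w, (S.Adj x y ∨ (w ∈ K ∧ w ≠ z)) → False := by
    intro w hw
    refine h3 z q x hzq hzq' (hx z hz) hqx.symm (connOn_of x fun B hB hxB => ?_)
    refine eq_empty_of_closedIn_cross h2 hK hz hqO hB hxB fun hyB => hxB ?_
    have hxA : x ∈ ({z, q}ᶜ : Finset V) := by
      have := hqA.1
      simp only [Finset.mem_compl, Finset.mem_insert, Finset.mem_singleton, not_or] at this ⊢
      exact ⟨fun h => hzA.1 h.symm, fun h => this.1 h.symm⟩
    rcases hw with hw | ⟨hwK, hwz⟩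
    · exact hB.2 y hyB x hxA hw.symm
    · have hwB : w ∈ B := by
        refine hB.2 y hyB w ?_ (hy w hwK)
        simp only [Finset.mem_compl, Finset.mem_insert, Finset.mem_singleton, not_or]
        exact ⟨hwz, fun h => hqA.2 (h ▸ hwK)⟩
      exact hB.2 w hwB x hxA (hx w hwK).symm
  have hD : ∃ x y, x ≠ y ∧ ¬ S.Adj x y ∧ ∀ a, S.Adj z a ↔ a = x ∨ a = y := by
    refine ⟨x, y, hxy, fun h => hnot x (Or.inl h), fun a => ⟨fun ha => ?_, ?_⟩⟩
    · by_contra! hcon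
      have haK : a ∈ K := hK.2 z hz a (by simpa using hcon) ha
      exact hnot a (Or.inr ⟨haK, ha.ne.symm⟩)
    · rintro (rfl | rfl)
      · exact (hx z hz).symm
      · exact (hy z hz).symm
  have hcl : S.ClosedIn Finset.univ (Finset.univ.filter fun z =>
      ∃ x y, x ≠ y ∧ ¬ S.Adj x y ∧ ∀ a, S.Adj z a ↔ a = x ∨ a = y) := by
    refine ⟨Finset.subset_univ _, fun a ha b _ hab => ?_⟩
    simp only [Finset.mem_filter, Finset.mem_univ, true_and] at ha ⊢
    obtain ⟨x, y, hxy, hadj, hN⟩ := ha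
    rcases (hN b).1 hab with rfl | rfl
    · obtain ⟨q, hq, hqa, hqN⟩ := neighbor_of_degree_two h2 h3 hxy hadj hN
      exact ⟨a, q, hq.symm, hqa, hqN⟩
    · obtain ⟨q, hq, hqa, hqN⟩ := neighbor_of_degree_two h2 h3 hxy.symm (fun h => hadj h.symm)
        (fun c => (hN c).trans or_comm)
      exact ⟨a, q, hq.symm, hqa, hqN⟩
  have := h1 _ hcl ⟨z, by simpa using hD⟩
  have hz₀' := this ▸ Finset.mem_univ z₀
  simp only [Finset.mem_filter, Finset.mem_univ, true_and] at hz₀'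
  obtain ⟨x, y, hxy, hadj, hN⟩ := hz₀'
  obtain ⟨a, ha⟩ := hz₀ x y hxy hadj
  have := hN a
  tauto

end SimpleGraph

/-! ### Connected graphs in which each vertex has two neighbours -/

namespace SimpleGraph

variable {V : Type u} [Fintype V] [DecidableEq V] {S : SimpleGraph V}

/-- A finite connected graph in which each vertex has exactly two neighbours is a cycle. -/
theorem exists_iso_cycleGraph [Nonempty V] (h1 : S.ConnOn Finset.univ)
    (h : ∀ z, ∃ x y, x ≠ y ∧ ∀ a, S.Adj z a ↔ a = x ∨ a = y) :
    ∃ n, 3 ≤ n ∧ Nonempty (S ≃g cycleGraph n) := by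
  obtain ⟨z⟩ := ‹Nonempty V›
  have hcyc : S.IsCycles := by
    intro v _
    obtain ⟨x, y, hxy, hN⟩ := h v
    have : S.neighborSet v = {x, y} := by
      ext a
      simp [hN]
    rw [this, Set.ncard_pair hxy]
  obtain ⟨x, y, -, hN⟩ := h z
  obtain ⟨p, hp, -⟩ := hcyc.exists_cycle_toSubgraph_verts_eq_connectedComponentSupp
    (c := S.connectedComponentMk z) (v := z) rfl ⟨x, (hN x).2 (Or.inl rfl)⟩
  have h3 := hp.three_le_length
  obtain ⟨f⟩ := (cycleGraph_isContained_iff (G := S) (n := p.length) (by omega)).2 ⟨z, p, hp, rfl⟩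
  generalize p.length = n at h3 f
  obtain ⟨m, rfl⟩ : ∃ m, n = m + 3 := ⟨n - 3, by omega⟩
  -- The images of the two cycle neighbours of `v` already fill the two places for neighbours of `f
  -- v`. This yields both surjectivity and reflection of adjacency.
  have key : ∀ v w, S.Adj (f v) w → ∃ v', f v' = w ∧ (cycleGraph (m + 3)).Adj v v' := by
    intro v w hvw
    obtain ⟨x, y, hxy, hN⟩ := h (f v)
    have hsub : ((cycleGraph (m + 3)).neighborFinset v).image f ⊆ {x, y} := by
      intro a ha
      obtain ⟨v', hv', rfl⟩ := Finset.mem_image.1 ha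
      have := (hN (f v')).1 (f.toHom.map_adj ((mem_neighborFinset _ _ _).1 hv'))
      simpa using this
    have hcard : (((cycleGraph (m + 3)).neighborFinset v).image f).card = 2 := by
      rw [Finset.card_image_of_injective _ (show Function.Injective f from f.injective),
        card_neighborFinset_eq_degree, cycleGraph_degree_three_le]
    have heq := Finset.eq_of_subset_of_card_le hsub (by rw [hcard, Finset.card_pair hxy])
    have hw : w ∈ ({x, y} : Finset V) := by simpa using (hN w).1 hvw
    rw [← heq] at hw
    obtain ⟨v', hv', rfl⟩ := Finset.mem_image.1 hw
    exact ⟨v', rfl, (mem_neighborFinset _ _ _).1 hv'⟩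
  have hsurj : Function.Surjective f := by
    have hcl : S.ClosedIn Finset.univ (Finset.univ.image f) := by
      refine ⟨Finset.subset_univ _, fun x hx y _ hxy => ?_⟩
      obtain ⟨v, -, rfl⟩ := Finset.mem_image.1 hx
      obtain ⟨v', rfl, -⟩ := key v y hxy
      exact Finset.mem_image_of_mem _ (Finset.mem_univ _)
    have := h1 _ hcl ⟨f 0, Finset.mem_image_of_mem _ (Finset.mem_univ _)⟩
    intro y
    obtain ⟨v, -, hv⟩ := Finset.mem_image.1 (this ▸ Finset.mem_univ y)
    exact ⟨v, hv⟩
  let ψ : Fin (m + 3) ≃ V := Equiv.ofBijective f ⟨f.injective, hsurj⟩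
  refine ⟨m + 3, by omega, ⟨(RelIso.symm ⟨ψ, fun {a b} => ⟨fun hab => ?_, fun hab => ?_⟩⟩)⟩⟩
  · obtain ⟨b', hb', hadj⟩ := key a (f b) hab
    rwa [← f.injective hb']
  · exact f.toHom.map_adj hab

end SimpleGraph

/-! ### Forbidden patterns, greedy coloring and rigidity -/

namespace MultiHypergraph

variable {V : Type u} {E : Type v} {W : Type u'}

/-- The graph in which two vertices are adjacent if they have a common edge. -/
def shadow (G : MultiHypergraph V E) : SimpleGraph V where
  Adj x y := x ≠ y ∧ ∃ e, x ∈ G.inc e ∧ y ∈ G.inc e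
  symm := ⟨fun _ _ h => ⟨h.1.symm, h.2.imp fun _ he => ⟨he.2, he.1⟩⟩⟩
  loopless := ⟨fun _ h => h.1 rfl⟩

theorem exists_mem_inc_ne (G : MultiHypergraph V E) (e : E) (x : V) : ∃ y ∈ G.inc e, y ≠ x :=
  Finset.exists_mem_ne (G.two_le_card e) x

theorem Connected.connOn [Fintype V] [DecidableEq V] {G : MultiHypergraph V E} (h : G.Connected) :
    G.shadow.ConnOn Finset.univ := by
  intro B hB ⟨x, hx⟩
  refine Finset.eq_univ_of_forall fun y => ?_
  obtain ⟨q, p, s, hp, -, h0, hq, hinc⟩ := h x y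
  rw [← hq]
  refine Fin.induction (motive := fun i => p i ∈ B) (by rwa [h0]) (fun i hi => ?_) (Fin.last q)
  exact hB.2 _ hi _ (Finset.mem_univ _)
    ⟨fun h => (Fin.castSucc_lt_succ (i := i)).ne (hp h), s i, hinc i⟩

/-- The partial colorings `m ∈ M e` are forbidden on the edge `e`. Such families come from covers:
`M e` is given by the matching at `e`. -/
structure IsCorrespondence (G : MultiHypergraph V E) (L : V → Finset W)
    (M : E → Set (V → W)) : Prop where
  mem : ∀ e, ∀ m ∈ M e, ∀ x ∈ G.inc e, m x ∈ L x
  eq : ∀ e, ∀ m ∈ M e, ∀ m' ∈ M e, ∀ x ∈ G.inc e, m x = m' x → ∀ y ∈ G.inc e, m y = m' y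

/-- `φ` is a proper coloring of the vertices in `P`. -/
def Proper (G : MultiHypergraph V E) (L : V → Finset W) (M : E → Set (V → W)) (P : Finset V)
    (φ : V → W) : Prop :=
  (∀ x ∈ P, φ x ∈ L x) ∧ ∀ e, G.inc e ⊆ P → ∀ m ∈ M e, ∃ x ∈ G.inc e, φ x ≠ m x

variable {G : MultiHypergraph V E} {L : V → Finset W} {M : E → Set (V → W)}

theorem proper_empty (φ : V → W) : G.Proper L M ∅ φ := by
  refine ⟨by simp, fun e he => ?_⟩
  have := G.two_le_card e
  rw [Finset.subset_empty.1 he] at this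
  simp at this

theorem proper_singleton {u : V} {φ : V → W} (hu : φ u ∈ L u) : G.Proper L M {u} φ := by
  refine ⟨by simpa using hu, fun e he => ?_⟩
  have := (G.two_le_card e).trans (Finset.card_le_card he)
  simp at this

variable [DecidableEq V]

theorem Proper.update {P : Finset V} {φ : V → W} (hP : G.Proper L M P φ) {u : V} {c : W}
    (hc : c ∈ L u)
    (h : ∀ e, u ∈ G.inc e → G.inc e ⊆ insert u P → ∀ m ∈ M e, m u = c →
      (∀ x ∈ G.inc e, x ≠ u → m x = φ x) → False) :
    G.Proper L M (insert u P) (Function.update φ u c) := by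
  refine ⟨fun x hx => ?_, fun e he m hm => ?_⟩
  · by_cases hxu : x = u
    · subst hxu
      simpa using hc
    · rw [Function.update_of_ne hxu]
      exact hP.1 x ((Finset.mem_insert.1 hx).resolve_left hxu)
  · by_cases hu : u ∈ G.inc e
    · by_contra! hcon
      refine h e hu he m hm ?_ fun x hx hxu => ?_
      · simpa using (hcon u hu).symm
      · simpa [Function.update_of_ne hxu] using (hcon x hx).symm
    · have heP : G.inc e ⊆ P := fun x hx =>
        (Finset.mem_insert.1 (he hx)).resolve_left fun h => hu (h ▸ hx)
      obtain ⟨x, hx, hne⟩ := hP.2 e heP m hm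
      exact ⟨x, hx, by rwa [Function.update_of_ne (ne_of_mem_of_not_mem hx hu)]⟩

/-- An uncolored vertex can be colored if its list is larger than the number of edges that become
completely colored; if the list is still larger, then some colors may be excluded. -/
theorem Proper.exists_update (hC : G.IsCorrespondence L M) {P : Finset V} {φ : V → W}
    (hP : G.Proper L M P φ) {u : V} (T : Finset W) (D : Finset E)
    (hD : ∀ e, u ∈ G.inc e → G.inc e ⊆ insert u P → e ∈ D)
    (hcard : D.card + T.card < (L u).card) :
    ∃ c ∈ L u, c ∉ T ∧ G.Proper L M (insert u P) (Function.update φ u c) := by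
  classical
  -- The colors that `e` forbids at `u`. There is at most one, since the color of a second vertex of
  -- `e` determines the pattern.
  let F : E → Finset W := fun e =>
    if u ∈ G.inc e then
      (L u).filter fun c => ∃ m ∈ M e, m u = c ∧ ∀ x ∈ G.inc e, x ≠ u → m x = φ x
    else ∅
  have hF : ∀ e ∈ D, (F e).card ≤ 1 := by
    intro e _
    refine Finset.card_le_one.2 fun a ha b hb => ?_
    by_cases hu : u ∈ G.inc e
    · simp only [F, if_pos hu, Finset.mem_filter] at ha hb
      obtain ⟨-, m, hm, rfl, hmφ⟩ := ha
      obtain ⟨-, m', hm', rfl, hmφ'⟩ := hb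
      obtain ⟨x, hx, hxu⟩ := G.exists_mem_inc_ne e u
      exact hC.eq e m hm m' hm' x hx ((hmφ x hx hxu).trans (hmφ' x hx hxu).symm) u hu
    · simp [F, hu] at ha
  have h1 := Finset.card_biUnion_le_card_mul D F 1 hF
  have h2 : (D.biUnion F ∪ T).card < (L u).card := by
    have := Finset.card_union_le (D.biUnion F) T
    omega
  obtain ⟨c, hc, hcF⟩ := Finset.exists_mem_notMem_of_card_lt_card h2
  rw [Finset.mem_union, not_or] at hcF
  refine ⟨c, hc, hcF.2, hP.update hc fun e hu he m hm hmu hmφ => hcF.1 ?_⟩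
  refine Finset.mem_biUnion.2 ⟨e, hD e hu he, ?_⟩
  simp only [F, if_pos hu, Finset.mem_filter]
  exact ⟨hc, m, hm, hmu, hmφ⟩

/-- Greedy coloring: if `A` is connected, the vertices of `A` outside a nonempty subset `B` can be
colored one after the other, in the direction of `B`. -/
theorem Proper.greedy [Fintype V] [Fintype E] (hC : G.IsCorrespondence L M)
    (hL : ∀ x, G.degree x ≤ (L x).card) {P A : Finset V} {φ : V → W} (hP : G.Proper L M P φ)
    (hdis : Disjoint P A) (hA : G.shadow.ConnOn A) {B : Finset V} (hBA : B ⊆ A)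
    (hB : B.Nonempty) :
    ∃ ψ : V → W, G.Proper L M (P ∪ A \ B) ψ ∧ ∀ x ∉ A, ψ x = φ x := by
  classical
  induction hn : (A \ B).card generalizing B with
  | zero =>
    rw [Finset.card_eq_zero] at hn
    exact ⟨φ, by simpa [hn] using hP, fun _ _ => rfl⟩
  | succ n ih =>
    have hne : B ≠ A := by
      rintro rfl
      simp at hn
    obtain ⟨b, hb, u, huA, hadj, huB⟩ : ∃ b ∈ B, ∃ u ∈ A, G.shadow.Adj b u ∧ u ∉ B := by
      by_contra! hcon
      exact hne (hA B ⟨hBA, hcon⟩ hB)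
    have huAB : u ∈ A \ B := Finset.mem_sdiff.2 ⟨huA, huB⟩
    have hsd : A \ insert u B = (A \ B).erase u := by
      ext x
      simp only [Finset.mem_sdiff, Finset.mem_insert, Finset.mem_erase]
      tauto
    -- `u` is colored last: its edge to the still uncolored `b` stays incomplete, so fewer than
    -- `degree u` edges restrict it.
    obtain ⟨ψ, hψ, hψφ⟩ := ih (B := insert u B) (Finset.insert_subset huA hBA)
      (Finset.insert_nonempty _ _) (by rw [hsd, Finset.card_erase_of_mem huAB]; omega)
    have hins : insert u (P ∪ A \ insert u B) = P ∪ A \ B := by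
      rw [hsd, ← Finset.union_insert, Finset.insert_erase huAB]
    obtain ⟨-, e, hbe, hue⟩ := hadj
    obtain ⟨c, -, -, hc⟩ := hψ.exists_update hC (u := u) ∅
      ((Finset.univ.filter fun e => u ∈ G.inc e).erase e)
      (fun e' hu he' => by
        simp only [Finset.mem_erase, Finset.mem_filter, Finset.mem_univ, true_and]
        refine ⟨?_, hu⟩
        rintro rfl
        have hb' := he' hbe
        rw [hins, Finset.mem_union, Finset.mem_sdiff] at hb'
        rcases hb' with hb' | hb'
        · exact Finset.disjoint_left.1 hdis hb' (hBA hb)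
        · exact hb'.2 hb)
      (by
        have he : e ∈ Finset.univ.filter fun e => u ∈ G.inc e := by simpa using hue
        have h1 := Finset.card_erase_of_mem he
        have h2 := Finset.card_pos.2 ⟨e, he⟩
        have h3 := hL u
        unfold degree at h3
        rw [Finset.card_empty]
        omega)
    rw [hins] at hc
    refine ⟨_, hc, fun x hx => ?_⟩
    rw [Function.update_of_ne (ne_of_mem_of_not_mem huA hx).symm, hψφ x hx]

/-- In the absence of a proper coloring, in a coloring of all vertices but `w` each edge at `w`
forbids exactly one color of `w`, and these colors are different and exhaust the list of `w`. -/
theorem Proper.forbidden [Fintype V] [Fintype E] (hC : G.IsCorrespondence L M)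
    (hL : ∀ x, G.degree x ≤ (L x).card) (hbad : ∀ φ, ¬ G.Proper L M Finset.univ φ) {w : V}
    {ψ : V → W} (hψ : G.Proper L M {w}ᶜ ψ) :
    (L w).card = G.degree w ∧
    (∀ e, w ∈ G.inc e → ∃ m ∈ M e, ∀ x ∈ G.inc e, x ≠ w → m x = ψ x) ∧
    ∀ e e', w ∈ G.inc e → w ∈ G.inc e' → ∀ m ∈ M e, ∀ m' ∈ M e',
      (∀ x ∈ G.inc e, x ≠ w → m x = ψ x) → (∀ x ∈ G.inc e', x ≠ w → m' x = ψ x) →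
      m w = m' w → e = e' := by
  classical
  have hcol : ∀ c ∈ L w, ∃ e, w ∈ G.inc e ∧ ∃ m ∈ M e, m w = c ∧
      ∀ x ∈ G.inc e, x ≠ w → m x = ψ x := by
    intro c hc
    by_contra! hcon
    have := hψ.update hc fun e hw _ m hm hmw hmψ => by
      obtain ⟨x, hx, hxw, hne⟩ := hcon e hw m hm hmw
      exact hne (hmψ x hx hxw)
    rw [Finset.insert_compl_self] at this
    exact hbad _ this
  rcases isEmpty_or_nonempty E with hE | hE
  · have hLw : L w = ∅ := Finset.eq_empty_of_forall_notMem fun c hc => hE.elim (hcol c hc).choose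
    exact ⟨by simp [hLw, degree], fun e => hE.elim e, fun e => hE.elim e⟩
  have hVW : Nonempty (V → W) := ⟨ψ⟩
  choose! f hfw m hm hmw hmψ using hcol
  have hfinj : Set.InjOn f (L w : Set W) := by
    intro c hc c' hc' hcc
    obtain ⟨x, hx, hxw⟩ := G.exists_mem_inc_ne (f c) w
    rw [← hmw c hc, ← hmw c' hc']
    refine hC.eq (f c) _ (hm c hc) _ (hcc ▸ hm c' hc') x hx ?_ w (hfw c hc)
    rw [hmψ c hc x hx hxw, hmψ c' hc' x (hcc ▸ hx) hxw]
  have himg : (L w).image f ⊆ Finset.univ.filter fun e => w ∈ G.inc e := by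
    intro e he
    obtain ⟨c, hc, rfl⟩ := Finset.mem_image.1 he
    simpa using hfw c hc
  have hcardimg := Finset.card_image_of_injOn hfinj
  have hle := Finset.card_le_card himg
  have hLw := hL w
  unfold degree at hLw
  -- Each color is charged injectively to an edge at `w` that forbids it. There are at most `|L w|`
  -- such edges, so all of them are used.
  have hEq := Finset.eq_of_subset_of_card_le himg (by omega)
  have hsurj : ∀ e, w ∈ G.inc e → ∃ c ∈ L w, f c = e := fun e he =>
    Finset.mem_image.1 (hEq ▸ (by simpa using he : e ∈ Finset.univ.filter fun e => w ∈ G.inc e))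
  refine ⟨le_antisymm (by unfold degree; omega) (hL w), fun e he => ?_, ?_⟩
  · obtain ⟨c, hc, rfl⟩ := hsurj e he
    exact ⟨m c, hm c hc, hmψ c hc⟩
  · intro e e' he he' m₁ hm₁ m₂ hm₂ h₁ h₂ heq
    have huniq : ∀ e, w ∈ G.inc e → ∀ m' ∈ M e, (∀ x ∈ G.inc e, x ≠ w → m' x = ψ x) →
        f (m' w) = e := by
      intro e he m' hm' hm'ψ
      obtain ⟨c, hc, rfl⟩ := hsurj e he
      obtain ⟨x, hx, hxw⟩ := G.exists_mem_inc_ne (f c) w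
      have : m' w = m c w := hC.eq (f c) _ hm' _ (hm c hc) x hx
        (by rw [hm'ψ x hx hxw, hmψ c hc x hx hxw]) w he
      rw [this, hmw c hc]
    rw [← huniq e he m₁ hm₁ h₁, ← huniq e' he' m₂ hm₂ h₂, heq]

/-- Uncolorable correspondences with lists at least as large as the degrees. -/
structure IsBad [Fintype V] [Fintype E] (G : MultiHypergraph V E) (L : V → Finset W)
    (M : E → Set (V → W)) : Prop extends G.IsCorrespondence L M where
  degree_le : ∀ x, G.degree x ≤ (L x).card
  not_proper : ∀ φ, ¬ G.Proper L M Finset.univ φ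

variable [Fintype V] [Fintype E]

/-- A proper coloring of `P` extends to all vertices but `w ∉ P`, if the complement of `P` is
connected. -/
theorem IsBad.exists_extension (h : G.IsBad L M) {P : Finset V} {φ : V → W}
    (hP : G.Proper L M P φ) (hconn : G.shadow.ConnOn Pᶜ) {w : V} (hw : w ∉ P) :
    ∃ ψ : V → W, G.Proper L M {w}ᶜ ψ ∧ ∀ x ∈ P, ψ x = φ x := by
  obtain ⟨ψ, hψ, hψφ⟩ := hP.greedy h.toIsCorrespondence h.degree_le disjoint_compl_right hconn
    (B := {w}) (by simpa using hw) (Finset.singleton_nonempty w)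
  refine ⟨ψ, ?_, fun x hx => hψφ x (by simpa using hx)⟩
  have : P ∪ Pᶜ \ {w} = {w}ᶜ := by
    ext x
    simp only [Finset.mem_union, Finset.mem_sdiff, Finset.mem_compl, Finset.mem_singleton]
    constructor
    · rintro (hx | hx)
      · rintro rfl
        exact hw hx
      · exact hx.2
    · tauto
  rwa [this] at hψ

/-- Rigidity with nothing precolored. This gives the bound `Δ + 1` and, for lists of size at least
`Δ`, regularity. -/
theorem IsBad.card_eq (h : G.IsBad L M) (hconn : G.shadow.ConnOn Finset.univ) (w : V) :
    (L w).card = G.degree w := by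
  rcases isEmpty_or_nonempty W with hW | ⟨⟨c⟩⟩
  · have := h.degree_le w
    rw [Finset.eq_empty_of_isEmpty (L w), Finset.card_empty] at this ⊢
    omega
  obtain ⟨ψ, hψ, -⟩ := h.exists_extension (proper_empty fun _ => c) (by simpa using hconn)
    (w := w) (by simp)
  exact (hψ.forbidden h.toIsCorrespondence h.degree_le h.not_proper).1

/-- A proper coloring of `P` is compatible with a forbidden pattern on each edge that is not
contained in `P`, if the complement of `P` is connected. -/
theorem IsBad.exists_pattern (h : G.IsBad L M) {P : Finset V} {φ : V → W}
    (hP : G.Proper L M P φ) (hconn : G.shadow.ConnOn Pᶜ) {e : E} (he : ¬ G.inc e ⊆ P) :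
    ∃ m ∈ M e, ∀ x ∈ G.inc e, x ∈ P → m x = φ x := by
  obtain ⟨w, hwe, hw⟩ := Finset.not_subset.1 he
  obtain ⟨ψ, hψ, hψφ⟩ := h.exists_extension hP hconn hw
  obtain ⟨m, hm, hmψ⟩ :=
    (hψ.forbidden h.toIsCorrespondence h.degree_le h.not_proper).2.1 e hwe
  exact ⟨m, hm, fun x hx hxP => by rw [hmψ x hx fun h => hw (h ▸ hxP), hψφ x hxP]⟩

/-- Two edges `e`, `e'` at an uncolored vertex `w` cannot forbid the same color of `w`. -/
theorem IsBad.edge_eq (h : G.IsBad L M) {P : Finset V} {φ : V → W}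
    (hP : G.Proper L M P φ) (hconn : G.shadow.ConnOn Pᶜ) {w : V} (hw : w ∉ P) {e e' : E}
    (he : w ∈ G.inc e) (he' : w ∈ G.inc e') (heP : G.inc e ⊆ insert w P)
    (heP' : G.inc e' ⊆ insert w P) {m m' : V → W} (hm : m ∈ M e) (hm' : m' ∈ M e')
    (hmφ : ∀ x ∈ G.inc e, x ≠ w → m x = φ x) (hmφ' : ∀ x ∈ G.inc e', x ≠ w → m' x = φ x)
    (heq : m w = m' w) : e = e' := by
  obtain ⟨ψ, hψ, hψφ⟩ := h.exists_extension hP hconn hw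
  refine (hψ.forbidden h.toIsCorrespondence h.degree_le h.not_proper).2.2 e e' he he' m hm m' hm'
    (fun x hx hxw => ?_) (fun x hx hxw => ?_) heq
  · rw [hmφ x hx hxw, hψφ x ((Finset.mem_insert.1 (heP hx)).resolve_left hxw)]
  · rw [hmφ' x hx hxw, hψφ x ((Finset.mem_insert.1 (heP' hx)).resolve_left hxw)]

/-- If `u` is not a cut vertex, then each color of `u` is in a forbidden pattern of each edge. -/
theorem IsBad.exists_mem (h : G.IsBad L M) {u : V} (hconn : G.shadow.ConnOn {u}ᶜ) {e : E}
    (hu : u ∈ G.inc e) {c : W} (hc : c ∈ L u) : ∃ m ∈ M e, m u = c := by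
  obtain ⟨m, hm, hmφ⟩ := h.exists_pattern (P := {u}) (φ := fun _ => c) (proper_singleton hc) hconn
    (e := e) (fun he => by
      have := (G.two_le_card e).trans (Finset.card_le_card he)
      simp at this)
  exact ⟨m, hm, hmφ u hu (by simp)⟩

end MultiHypergraph

/-! ### Cut vertices and edges with more than two vertices -/

namespace MultiHypergraph

variable {V : Type u} {E : Type v} {W : Type u'} [DecidableEq V]
  {G : MultiHypergraph V E} {L : V → Finset W} {M : E → Set (V → W)}

theorem degree_pos [Fintype E] {x : V} {e : E} (he : x ∈ G.inc e) : 0 < G.degree x :=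
  Finset.card_pos.2 ⟨e, by simpa using he⟩

theorem exists_adj_of_closedIn_compl [Fintype V] (hconn : G.shadow.ConnOn Finset.univ)
    {v : V} {K : Finset V} (hK : G.shadow.ClosedIn {v}ᶜ K) (hne : K.Nonempty) :
    ∃ u ∈ K, G.shadow.Adj u v := by
  by_contra! hcon
  have hv : v ∉ K := fun h => by simpa using hK.1 h
  have hcl : G.shadow.ClosedIn Finset.univ K := by
    refine ⟨Finset.subset_univ _, fun a ha b _ hab => hK.2 a ha b ?_ hab⟩
    rw [Finset.mem_compl, Finset.mem_singleton]
    rintro rfl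
    exact hcon a ha hab
  exact hne.ne_empty (hconn.eq_empty hcl (Finset.mem_univ v) hv)

variable [Fintype V] [Fintype E]

theorem IsBad.nonempty (h : G.IsBad L M) {x : V} {e : E} (he : x ∈ G.inc e) : (L x).Nonempty :=
  Finset.card_pos.1 ((degree_pos he).trans_le (h.degree_le x))

/-- A connected hypergraph with an uncolorable correspondence whose lists have the same size has no
cut vertices. -/
theorem IsBad.connOn_compl_singleton (h : G.IsBad L M) (hconn : G.shadow.ConnOn Finset.univ)
    (hreg : ∀ x y, (L x).card = (L y).card) (v : V) : G.shadow.ConnOn {v}ᶜ := by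
  classical
  by_contra hv
  have hex : ∃ n, ∃ v K, G.shadow.ClosedIn {v}ᶜ K ∧ K.Nonempty ∧ K ≠ {v}ᶜ ∧ K.card = n := by
    unfold SimpleGraph.ConnOn at hv
    push Not at hv
    obtain ⟨K, hK, hKn, hK'⟩ := hv
    exact ⟨_, v, K, hK, hKn, hK', rfl⟩
  clear hv v
  obtain ⟨v, K, hK, hKn, hK', hcard⟩ := Nat.find_spec hex
  have hmin : ∀ v' K', G.shadow.ClosedIn {v'}ᶜ K' → K'.Nonempty → K' ≠ {v'}ᶜ →
      K.card ≤ K'.card := by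
    intro a C h₁ h₂ h₃
    rw [hcard]
    exact Nat.find_min' hex ⟨a, C, h₁, h₂, h₃, rfl⟩
  have hvK : v ∉ K := fun h => by simpa using hK.1 h
  have hO : ({v}ᶜ : Finset V) \ K = Kᶜ \ {v} := by
    ext x
    simp only [Finset.mem_sdiff, Finset.mem_compl, Finset.mem_singleton]
    tauto
  have hOcl := hK.sdiff
  rw [hO] at hOcl
  obtain ⟨u, huK, huv, e, hue, hve⟩ := exists_adj_of_closedIn_compl hconn hK hKn
  obtain ⟨o, hoO, hov, e₁, hoe₁, hve₁⟩ := exists_adj_of_closedIn_compl hconn hOcl (by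
    rw [← hO]
    exact Finset.sdiff_nonempty.2 fun h => hK' (Finset.Subset.antisymm hK.1 h))
  have hadj : ∀ a b, a ∈ K → G.shadow.Adj a b → b ≠ v → b ∈ K := fun a b ha hab hb =>
    hK.2 a ha b (by simpa using hb) hab
  have hcompl : G.shadow.ConnOn Kᶜ := by
    refine SimpleGraph.connOn_of v fun B hB hvB => ?_
    refine hconn.eq_empty ⟨Finset.subset_univ _, fun a ha b _ hab => ?_⟩ (Finset.mem_univ v) hvB
    refine hB.2 a ha b ?_ hab
    rw [Finset.mem_compl]
    exact fun hb => Finset.mem_compl.1 (hB.1 ha)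
      (hadj b a hb hab.symm fun h => hvB (h ▸ ha))
  have hins : G.shadow.ConnOn (Kᶜ \ {v})ᶜ := by
    refine SimpleGraph.connOn_of v fun B hB hvB => ?_
    have hBK : B ⊆ K := fun b hb => by
      have := hB.1 hb
      simp only [Finset.mem_compl, Finset.mem_sdiff, Finset.mem_singleton, not_and_or,
        not_not] at this
      exact this.resolve_right fun h => hvB (h ▸ hb)
    by_contra hne
    have hcl : G.shadow.ClosedIn {v}ᶜ B := by
      refine ⟨hBK.trans hK.1, fun a ha b hb hab => hB.2 a ha b ?_ hab⟩
      have := hK.2 a (hBK ha) b hb hab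
      simp [this]
    have hle := hmin v B hcl (Finset.nonempty_iff_ne_empty.2 hne) fun h' =>
      hK' (Finset.Subset.antisymm hK.1 (h' ▸ hBK))
    have heq := Finset.eq_of_subset_of_card_le hBK hle
    exact hvB (hB.2 u (heq ▸ huK) v (by simp) ⟨huv, e, hue, hve⟩)
  obtain ⟨c₀, -⟩ := h.nonempty hue
  obtain ⟨φ, hφ, -⟩ := (proper_empty fun _ => c₀).greedy h.toIsCorrespondence h.degree_le
    (Finset.disjoint_empty_left _) hcompl (B := {v}) (by simpa using hvK)
    (Finset.singleton_nonempty v)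
  rw [Finset.empty_union] at hφ
  have he₁ : ∀ x ∈ G.inc e₁, x ≠ v → x ∈ Kᶜ \ {v} := by
    intro x hx hxv
    by_cases hxo : x = o
    · exact hxo ▸ hoO
    · exact hOcl.2 o hoO x (by simpa using hxv) ⟨Ne.symm hxo, e₁, hoe₁, hx⟩
  obtain ⟨m₁, hm₁, hm₁φ⟩ := h.exists_pattern hφ hins (e := e₁) fun hsub => by
    simpa using hsub hve₁
  have huO : u ∉ Kᶜ \ {v} := by simp [huK]
  -- The complement is `(K \ {u}) ∪ {v}`. A closed part of it without `v` would be a fragment at the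
  -- cut vertex `u` smaller than `K`.
  have hconn' : G.shadow.ConnOn (insert u (Kᶜ \ {v}))ᶜ := by
    refine SimpleGraph.connOn_of v fun B hB hvB => ?_
    have hB' : ∀ b ∈ B, b ∈ K ∧ b ≠ u := fun b hb => by
      have := hB.1 hb
      simp only [Finset.mem_compl, Finset.mem_insert, Finset.mem_sdiff, Finset.mem_singleton,
        not_or, not_and_or, not_not] at this
      exact ⟨this.2.resolve_right fun h => hvB (h ▸ hb), this.1⟩
    by_contra hne
    have hcl : G.shadow.ClosedIn {u}ᶜ B := by
      refine ⟨fun b hb => by simpa using (hB' b hb).2, fun a ha b hb hab => hB.2 a ha b ?_ hab⟩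
      simp only [Finset.mem_compl, Finset.mem_insert, Finset.mem_sdiff, Finset.mem_singleton,
        not_or, not_and_or, not_not] at hb ⊢
      refine ⟨hb, ?_⟩
      by_cases hbv : b = v
      · exact Or.inr hbv
      · exact Or.inl (hadj a b (hB' a ha).1 hab hbv)
    have hle := hmin u B hcl (Finset.nonempty_iff_ne_empty.2 hne) fun h' =>
      hvB (h' ▸ (by simpa using huv.symm))
    have hBK : B ⊆ K := fun b hb => (hB' b hb).1
    exact (hB' u (Finset.eq_of_subset_of_card_le hBK hle ▸ huK)).2 rfl
  have hupd : ∀ c ∈ L u, G.Proper L M (insert u (Kᶜ \ {v})) (Function.update φ u c) := by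
    intro c hc
    refine hφ.update hc fun e' hu' he' _ _ _ _ => ?_
    obtain ⟨y, hy, hyu⟩ := G.exists_mem_inc_ne e' u
    have hyO := (Finset.mem_insert.1 (he' hy)).resolve_left hyu
    rw [Finset.mem_sdiff, Finset.mem_compl, Finset.mem_singleton] at hyO
    exact hyO.1 (hadj u y huK ⟨hyu.symm, e', hu', hy⟩ hyO.2)
  have hve' : ¬ G.inc e ⊆ insert u (Kᶜ \ {v}) := fun hsub => by
    have := hsub hve
    simp only [Finset.mem_insert, Finset.mem_sdiff, Finset.mem_singleton, not_true_eq_false,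
      and_false, or_false] at this
    exact huv this.symm
  have hpat : ∀ c ∈ L u, ∃ m ∈ M e, m u = c := by
    intro c hc
    obtain ⟨m, hm, hmφ⟩ := h.exists_pattern (hupd c hc) hconn' hve'
    exact ⟨m, hm, by simpa using hmφ u hue (Finset.mem_insert_self _ _)⟩
  have hVW : Nonempty (V → W) := ⟨φ⟩
  choose! f hf hfu using hpat
  -- Equal list sizes turn this injection into a bijection. So `u` can be given a color for which
  -- `e` forbids at `v` the same color as `e₁`, whose other vertices lie beyond `v`.
  have himg : (L u).image (fun c => f c v) = L v := by
    refine Finset.eq_of_subset_of_card_le (fun b hb => ?_) ?_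
    · obtain ⟨c, hc, rfl⟩ := Finset.mem_image.1 hb
      exact h.mem e _ (hf c hc) v hve
    · rw [Finset.card_image_of_injOn, hreg]
      intro c hc c' hc' hcc
      rw [← hfu c hc, ← hfu c' hc']
      exact h.eq e _ (hf c hc) _ (hf c' hc') v hve hcc u hue
  obtain ⟨c, hc, hcv⟩ := Finset.mem_image.1 (himg ▸ h.mem e₁ m₁ hm₁ v hve₁)
  obtain ⟨ψ, hψ, hψφ⟩ := h.exists_extension (hupd c hc) hconn' (w := v) (by
    simpa using huv.symm)
  have hforb := (hψ.forbidden h.toIsCorrespondence h.degree_le h.not_proper).2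
  obtain ⟨m, hm, hmψ⟩ := hforb.1 e hve
  have hmv : m v = m₁ v := by
    rw [← hcv]
    refine h.eq e m hm _ (hf c hc) u hue ?_ v hve
    rw [hmψ u hue huv, hψφ u (Finset.mem_insert_self _ _), hfu c hc, Function.update_self]
  have hee := hforb.2 e e₁ hve hve₁ m hm m₁ hm₁ hmψ (fun x hx hxv => by
    have hxO := he₁ x hx hxv
    rw [hm₁φ x hx hxO, hψφ x (Finset.mem_insert_of_mem hxO),
      Function.update_of_ne (ne_of_mem_of_not_mem hxO huO)]) hmv
  subst hee
  exact huO (he₁ u hue huv)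

/-- A connected hypergraph in which all degrees are `1` is a single edge. -/
theorem isSingleEdge_of_degree_eq_one (hconn : G.shadow.ConnOn Finset.univ) (x : V)
    (hdeg : ∀ x, G.degree x = 1) : G.IsSingleEdge := by
  have huniq : ∀ x e e', x ∈ G.inc e → x ∈ G.inc e' → e = e' := fun x e e' he he' =>
    Finset.card_le_one.1 (hdeg x).le e (by simpa using he) e' (by simpa using he')
  obtain ⟨e, he⟩ := Finset.card_pos.1 (show 0 < G.degree x by rw [hdeg]; exact one_pos)
  replace he : x ∈ G.inc e := by simpa using he
  have hcl : G.shadow.ClosedIn Finset.univ (G.inc e) := by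
    refine ⟨Finset.subset_univ _, fun a ha b _ ⟨_, e', ha', hb'⟩ => ?_⟩
    rwa [huniq a e e' ha ha']
  have hall := hconn _ hcl ⟨x, he⟩
  refine ⟨e, fun e' => ?_, fun y => hall ▸ Finset.mem_univ y⟩
  obtain ⟨y, hy, -⟩ := G.exists_mem_inc_ne e' x
  exact huniq y e' e hy (hall ▸ Finset.mem_univ y)

/-- Let `a`, `b`, `w` be vertices of an edge `e`. Then `e` is the only edge that joins `b` to the
component of `w` in the complement of `{a, b}`. -/
theorem IsBad.eq_of_mem_comp (h : G.IsBad L M) (hconn : G.shadow.ConnOn Finset.univ)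
    (hb : ∀ v, G.shadow.ConnOn {v}ᶜ) {e g : E} {a b w x : V} (hab : a ≠ b) (hwa : w ≠ a)
    (hwb : w ≠ b) (hae : a ∈ G.inc e) (hbe : b ∈ G.inc e) (hwe : w ∈ G.inc e)
    (hbg : b ∈ G.inc g) (hxg : x ∈ G.inc g) (hx : x ∈ G.shadow.comp {a, b}ᶜ w) : g = e := by
  classical
  by_contra hge
  have hwA : w ∈ ({a, b}ᶜ : Finset V) := by simp [hwa, hwb]
  have hwK := SimpleGraph.mem_comp_self (S := G.shadow) hwA
  have hKcl := SimpleGraph.closedIn_comp (S := G.shadow) {a, b}ᶜ w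
  have hKconn := SimpleGraph.connOn_comp (S := G.shadow) hwA
  generalize G.shadow.comp {a, b}ᶜ w = K at *
  have haK : a ∉ K := fun h => by simpa using hKcl.1 h
  have hbK : b ∉ K := fun h => by simpa using hKcl.1 h
  have hcompl : G.shadow.ConnOn Kᶜ := by
    refine SimpleGraph.connOn_of a fun B hB haB => ?_
    have hbB : b ∉ B := fun hbB =>
      haB (hB.2 b hbB a (by simpa using haK) ⟨hab.symm, e, hbe, hae⟩)
    refine hconn.eq_empty ⟨Finset.subset_univ _, fun y hy z _ hyz => hB.2 y hy z ?_ hyz⟩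
      (Finset.mem_univ a) haB
    rw [Finset.mem_compl]
    refine fun hz => Finset.mem_compl.1 (hB.1 hy) (hKcl.2 z hz y ?_ hyz.symm)
    simp only [Finset.mem_compl, Finset.mem_insert, Finset.mem_singleton, not_or]
    exact ⟨fun h => haB (h ▸ hy), fun h => hbB (h ▸ hy)⟩
  obtain ⟨c₀, -⟩ := h.nonempty hae
  obtain ⟨φ, hφ, -⟩ := (proper_empty fun _ => c₀).greedy h.toIsCorrespondence h.degree_le
    (Finset.disjoint_empty_left _) hcompl (B := {b}) (by simpa using hbK)
    (Finset.singleton_nonempty b)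
  rw [Finset.empty_union] at hφ
  have haP : a ∈ Kᶜ \ {b} := by simp [haK, hab]
  obtain ⟨m, hm, hma⟩ := h.exists_mem (hb a) hae (hφ.1 a haP)
  have hins : insert b (Kᶜ \ {b}) = Kᶜ := by
    rw [Finset.insert_sdiff_self_of_mem (by simpa using hbK)]
  -- Both `e` and `g` still meet the uncolored set `K`, so at least two edges at `b` do not restrict
  -- it. This leaves room to avoid also `m b`, the only color of `b` that occurs in a pattern of `e`
  -- with the color of `a`.
  obtain ⟨c, -, hcT, hc⟩ := hφ.exists_update h.toIsCorrespondence (u := b) {m b}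
    (((Finset.univ.filter fun e => b ∈ G.inc e).erase e).erase g)
    (fun e' hbe' he' => by
      rw [hins] at he'
      simp only [Finset.mem_erase, Finset.mem_filter, Finset.mem_univ, true_and]
      refine ⟨?_, ?_, hbe'⟩
      · rintro rfl
        exact Finset.mem_compl.1 (he' hxg) hx
      · rintro rfl
        exact Finset.mem_compl.1 (he' hwe) hwK)
    (by
      have he : e ∈ Finset.univ.filter fun e => b ∈ G.inc e := by simpa using hbe
      have hg : g ∈ (Finset.univ.filter fun e => b ∈ G.inc e).erase e := by simp [hge, hbg]
      have h1 := Finset.card_erase_of_mem he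
      have h2 := Finset.card_erase_of_mem hg
      have h3 := Finset.card_pos.2 ⟨g, hg⟩
      have h4 := h.degree_le b
      unfold degree at h4
      rw [Finset.card_singleton]
      omega)
  rw [hins] at hc
  obtain ⟨m', hm', hmφ⟩ := h.exists_pattern hc (by rwa [compl_compl]) (e := e) fun hsub =>
    Finset.mem_compl.1 (hsub hwe) hwK
  have ha' := hmφ a hae (by simpa using haK)
  have hb' := hmφ b hbe (by simpa using hbK)
  rw [Function.update_of_ne hab] at ha'
  rw [Function.update_self] at hb'
  have := h.eq e m' hm' m hm a hae (by rw [ha', hma]) b hbe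
  exact hcT (by rw [Finset.mem_singleton, ← hb', this])

/-- If no vertex has degree `1`, then there are no edges with more than two vertices. -/
theorem IsBad.card_inc (h : G.IsBad L M) (hconn : G.shadow.ConnOn Finset.univ)
    (hb : ∀ v, G.shadow.ConnOn {v}ᶜ) (hdeg : ∀ x, G.degree x ≠ 1) (e : E) :
    (G.inc e).card = 2 := by
  classical
  by_contra hcard
  have h3 : 2 < (G.inc e).card := lt_of_le_of_ne (G.two_le_card e) (Ne.symm hcard)
  have hthird : ∀ a ∈ G.inc e, ∀ b ∈ G.inc e, ∃ w ∈ G.inc e, w ≠ a ∧ w ≠ b := by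
    intro a ha b hb
    by_contra! hcon
    have : G.inc e ⊆ {a, b} := fun w hw => by
      by_cases hwa : w = a
      · simp [hwa]
      · simp [hcon w hw hwa]
    have := (Finset.card_le_card this).trans Finset.card_le_two
    omega
  obtain ⟨a, hae⟩ := Finset.card_pos.1 (show 0 < (G.inc e).card by omega)
  obtain ⟨g, hag, hge⟩ : ∃ g, a ∈ G.inc g ∧ g ≠ e := by
    have h1 := degree_pos hae
    have h2 : 1 < G.degree a := lt_of_le_of_ne h1 (Ne.symm (hdeg a))
    obtain ⟨g, hg, hge⟩ := Finset.exists_mem_ne h2 e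
    exact ⟨g, by simpa using hg, hge⟩
  obtain ⟨x, hxg, hxa⟩ := G.exists_mem_inc_ne g a
  have key : ∀ b ∈ G.inc e, ∀ w ∈ G.inc e, b ≠ a → w ≠ a → b ≠ w →
      x ∉ G.shadow.comp {w, a}ᶜ b := fun b hbe w hwe hba hwa hbw hx =>
    hge (h.eq_of_mem_comp hconn hb hwa hbw hba hwe hae hbe hag hxg hx)
  by_cases hxe : x ∈ G.inc e
  · obtain ⟨w, hwe, hwa, hwx⟩ := hthird a hae x hxe
    exact key x hxe w hwe hxa hwa hwx.symm
      (SimpleGraph.mem_comp_self (by simp [hxa, hwx.symm]))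
  · have hxA : x ∈ (G.inc e)ᶜ := by simpa using hxe
    have hQcl := SimpleGraph.closedIn_comp (S := G.shadow) (G.inc e)ᶜ x
    have hQconn := SimpleGraph.connOn_comp (S := G.shadow) hxA
    have hxQ := SimpleGraph.mem_comp_self (S := G.shadow) hxA
    generalize G.shadow.comp (G.inc e)ᶜ x = Q at *
    -- As `a` is not a cut vertex, `Q` is attached to `e` elsewhere. Deleting `a` and a third vertex
    -- of `e` then leaves `x` in the component of `b`, against `key`.
    obtain ⟨b, hbe, hba, q, hqQ, hqb⟩ : ∃ b ∈ G.inc e, b ≠ a ∧ ∃ q ∈ Q, G.shadow.Adj q b := by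
      by_contra! hcon
      obtain ⟨b, hbe, hba⟩ := G.exists_mem_inc_ne e a
      have hcl : G.shadow.ClosedIn {a}ᶜ Q := by
        refine ⟨fun q hq => ?_, fun q hq y hy hqy => hQcl.2 q hq y ?_ hqy⟩
        · rw [Finset.mem_compl, Finset.mem_singleton]
          rintro rfl
          exact Finset.mem_compl.1 (hQcl.1 hq) hae
        · rw [Finset.mem_compl]
          exact fun hye => hcon y hye (by simpa using hy) q hq hqy
      have := (hb a).eq_empty hcl (v := b) (by simpa using hba)
        (fun h => Finset.mem_compl.1 (hQcl.1 h) hbe)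
      simp [this] at hxQ
    obtain ⟨w, hwe, hwa, hwb⟩ := hthird a hae b hbe
    have hbA : b ∈ ({w, a}ᶜ : Finset V) := by simp [hba, hwb.symm]
    have hQA : Q ⊆ ({w, a}ᶜ : Finset V) := fun y hy => by
      have hye := Finset.mem_compl.1 (hQcl.1 hy)
      simp only [Finset.mem_compl, Finset.mem_insert, Finset.mem_singleton, not_or]
      exact ⟨fun h => hye (h ▸ hwe), fun h => hye (h ▸ hae)⟩
    have hcl := SimpleGraph.closedIn_comp (S := G.shadow) ({w, a}ᶜ) b
    refine key b hbe w hwe hba hwa hwb.symm (hQconn.subset_of_mem hQA hcl hqQ ?_ hxQ)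
    exact hcl.2 b (SimpleGraph.mem_comp_self hbA) q (hQA hqQ) hqb.symm

end MultiHypergraph

/-! ### Edges with two vertices: separating pairs and multiplicities -/

namespace MultiHypergraph

variable {V : Type u} {E : Type v} {W : Type u'}

/-- The color `a` of `x` and the color `b` of `y` are forbidden together by an edge. -/
def Conflict (G : MultiHypergraph V E) (M : E → Set (V → W)) (x y : V) (a b : W) : Prop :=
  ∃ e, x ∈ G.inc e ∧ y ∈ G.inc e ∧ ∃ m ∈ M e, m x = a ∧ m y = b

variable {G : MultiHypergraph V E} {L : V → Finset W} {M : E → Set (V → W)}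

theorem Conflict.symm {x y : V} {a b : W} (h : G.Conflict M x y a b) : G.Conflict M y x b a := by
  obtain ⟨e, hx, hy, m, hm, ha, hb⟩ := h
  exact ⟨e, hy, hx, m, hm, hb, ha⟩

variable [DecidableEq V]

theorem inc_eq_pair (hG : ∀ e, (G.inc e).card = 2) {e : E} {x y : V} (hxy : x ≠ y)
    (hx : x ∈ G.inc e) (hy : y ∈ G.inc e) : G.inc e = {x, y} := by
  refine (Finset.eq_of_subset_of_card_le ?_ ?_).symm
  · intro z hz
    rcases Finset.mem_insert.1 hz with rfl | hz
    · exact hx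
    · rwa [Finset.mem_singleton.1 hz]
  · rw [hG, Finset.card_pair hxy]

section Mult

variable [Fintype E]

/-- The number of edges that contain both `x` and `y`. -/
def mult (G : MultiHypergraph V E) (x y : V) : ℕ :=
  (Finset.univ.filter fun e => x ∈ G.inc e ∧ y ∈ G.inc e).card

variable {G : MultiHypergraph V E}

theorem mult_comm (x y : V) : G.mult x y = G.mult y x := by
  unfold mult
  simp only [and_comm]

theorem mult_pos_of_adj {x y : V} (h : G.shadow.Adj x y) : 0 < G.mult x y := by
  obtain ⟨-, e, he⟩ := h
  exact Finset.card_pos.2 ⟨e, by simpa using he⟩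

theorem degree_eq_mult_add_mult (hG : ∀ e, (G.inc e).card = 2) {x y z : V} (hyz : y ≠ z)
    (hN : ∀ a, G.shadow.Adj x a ↔ a = y ∨ a = z) : G.degree x = G.mult x y + G.mult x z := by
  classical
  unfold degree mult
  rw [← Finset.card_union_of_disjoint]
  · congr 1
    ext e
    simp only [Finset.mem_filter, Finset.mem_univ, true_and, Finset.mem_union]
    refine ⟨fun hx => ?_, by tauto⟩
    obtain ⟨a, ha, hax⟩ := G.exists_mem_inc_ne e x
    rcases (hN a).1 ⟨hax.symm, e, hx, ha⟩ with rfl | rfl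
    · exact Or.inl ⟨hx, ha⟩
    · exact Or.inr ⟨hx, ha⟩
  · rw [Finset.disjoint_left]
    intro e he he'
    simp only [Finset.mem_filter, Finset.mem_univ, true_and] at he he'
    have hxy : x ≠ y := ((hN y).2 (Or.inl rfl)).ne
    have hxz : x ≠ z := ((hN z).2 (Or.inr rfl)).ne
    have := inc_eq_pair hG hxy he.1 he.2 ▸ he'.2
    simp only [Finset.mem_insert, Finset.mem_singleton] at this
    exact this.elim (fun h => hxz h.symm) fun h => hyz h.symm

end Mult

variable [Fintype E]

open Classical in
/-- A color of `x` has conflicts with at most `mult x y` colors of `y`. -/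
theorem IsCorrespondence.card_conflict_le (h : G.IsCorrespondence L M) (x y : V) (a : W) :
    ((L y).filter fun b => G.Conflict M x y a b).card ≤ G.mult x y := by
  let F : E → Finset W := fun e => (L y).filter fun b => ∃ m ∈ M e, m x = a ∧ m y = b
  have hsub : ((L y).filter fun b => G.Conflict M x y a b) ⊆
      (Finset.univ.filter fun e => x ∈ G.inc e ∧ y ∈ G.inc e).biUnion F := by
    intro b hb
    obtain ⟨hbL, e, hx, hy, hm⟩ := Finset.mem_filter.1 hb
    exact Finset.mem_biUnion.2 ⟨e, by simp [hx, hy], Finset.mem_filter.2 ⟨hbL, hm⟩⟩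
  refine (Finset.card_le_card hsub).trans
    ((Finset.card_biUnion_le_card_mul _ F 1 fun e he => ?_).trans (mul_one _).le)
  simp only [Finset.mem_filter, Finset.mem_univ, true_and] at he
  refine Finset.card_le_one.2 fun b hb b' hb' => ?_
  obtain ⟨-, m, hm, hmx, rfl⟩ := Finset.mem_filter.1 hb
  obtain ⟨-, m', hm', hmx', rfl⟩ := Finset.mem_filter.1 hb'
  exact h.eq e m hm m' hm' x he.1 (hmx.trans hmx'.symm) y he.2

variable [Fintype V]

/-- If `u`, `v` are nonadjacent vertices with a common neighbour, then `{u, v}` separates. -/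
theorem IsBad.not_connOn_compl_pair (h : G.IsBad L M) (hb : ∀ v, G.shadow.ConnOn {v}ᶜ)
    (hG : ∀ e, (G.inc e).card = 2) {u v w : V} (huv : u ≠ v) (hadj : ¬ G.shadow.Adj u v)
    (hwu : G.shadow.Adj w u) (hwv : G.shadow.Adj w v) : ¬ G.shadow.ConnOn {u, v}ᶜ := by
  intro hconn
  obtain ⟨hwu', e, hwe, hue⟩ := hwu
  obtain ⟨hwv', e', hwe', hve'⟩ := hwv
  obtain ⟨c, hc⟩ := h.nonempty hue
  obtain ⟨m, hm, hmu⟩ := h.exists_mem (hb u) hue hc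
  obtain ⟨m', hm', hmw⟩ := h.exists_mem (hb w) hwe' (h.mem e m hm w hwe)
  have hinc := inc_eq_pair hG hwu' hwe hue
  have hinc' := inc_eq_pair hG hwv' hwe' hve'
  -- The colors of `u` and `v` are chosen so that both edges forbid the color `m w` at `w`. The
  -- choice is proper because `u` and `v` are not adjacent.
  have hee := h.edge_eq (P := {u, v}) (φ := fun x => if x = u then m u else m' v) ?_ hconn
    (w := w) (by simp [hwu', hwv']) hwe hwe' ?_ ?_ hm hm' ?_ ?_ hmw.symm
  · subst hee
    rw [hinc'] at hue
    simp only [Finset.mem_insert, Finset.mem_singleton] at hue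
    exact hue.elim (fun h => hwu' h.symm) huv
  · refine ⟨?_, fun e he => ?_⟩
    · simp [huv.symm, h.mem e m hm u hue, h.mem e' m' hm' v hve']
    · have heq := Finset.eq_of_subset_of_card_le he (by rw [hG, Finset.card_pair huv])
      exact absurd ⟨huv, e, by simp [heq], by simp [heq]⟩ hadj
  · simp [hinc, Finset.subset_iff]
  · simp [hinc', Finset.subset_iff]
  · simp [hinc]
  · simp [hinc', huv.symm]

/-- In the complement of a nonseparating pair `{u, v}`, the edges between `w` and `v` are at most as
many as those between `u` and `v`, if `w` is a neighbour of `u`. -/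
theorem IsBad.mult_le (h : G.IsBad L M) (hb : ∀ v, G.shadow.ConnOn {v}ᶜ)
    (hG : ∀ e, (G.inc e).card = 2) {u v w : V} (huv : u ≠ v) (hwv : w ≠ v)
    (hwu : G.shadow.Adj w u) (hconn : G.shadow.ConnOn {u, v}ᶜ) : G.mult w v ≤ G.mult u v := by
  classical
  obtain ⟨hwu', e₀, hwe₀, hue₀⟩ := hwu
  obtain ⟨c, hc⟩ := h.nonempty hue₀
  obtain ⟨m₀, hm₀, hmu⟩ := h.exists_mem (hb u) hue₀ hc
  have hinc₀ := inc_eq_pair hG hwu' hwe₀ hue₀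
  have hpat : ∀ e, w ∈ G.inc e → ∃ m ∈ M e, m w = m₀ w := fun e he =>
    h.exists_mem (hb w) he (h.mem e₀ m₀ hm₀ w hwe₀)
  have hVW : Nonempty (V → W) := ⟨m₀⟩
  choose! f hf hfw using hpat
  -- With `c` on `u` and `f e v` on `v`, the edges `e₀` and `e` would forbid the same color at `w`.
  -- So this precoloring is not proper, and only an edge `uv` can forbid it.
  have hex : ∀ e, w ∈ G.inc e ∧ v ∈ G.inc e → ∃ e', (u ∈ G.inc e' ∧ v ∈ G.inc e') ∧
      ∃ m ∈ M e', m u = c ∧ m v = f e v := by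
    rintro e ⟨hwe, hve⟩
    by_contra! hcon
    have hinc := inc_eq_pair hG hwv hwe hve
    have hee := h.edge_eq (P := {u, v}) (φ := fun x => if x = u then c else f e v) ?_ hconn
      (w := w) (by simp [hwu', hwv]) hwe₀ hwe ?_ ?_ hm₀ (hf e hwe) ?_ ?_ (hfw e hwe).symm
    · subst hee
      rw [hinc] at hue₀
      simp only [Finset.mem_insert, Finset.mem_singleton] at hue₀
      exact hue₀.elim (fun h => hwu' h.symm) huv
    · refine ⟨?_, fun e' he' m hm => ?_⟩
      · simp [huv.symm, hc, h.mem e _ (hf e hwe) v hve]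
      · have heq := Finset.eq_of_subset_of_card_le he' (by rw [hG, Finset.card_pair huv])
        by_contra! hall
        refine hcon e' ⟨by simp [heq], by simp [heq]⟩ m hm ?_ ?_
        · simpa using (hall u (by simp [heq])).symm
        · simpa [huv.symm] using (hall v (by simp [heq])).symm
    · simp [hinc₀, Finset.subset_iff]
    · simp [hinc, Finset.subset_iff]
    · simp [hinc₀, hmu]
    · simp [hinc, huv.symm]
  rcases isEmpty_or_nonempty E with hE | hE
  · exact hE.elim e₀
  choose! g hg m hm hmu' hmv using hex
  refine Finset.card_le_card_of_injOn g (fun e he => ?_) fun e he e' he' hee => ?_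
  · simpa using hg e (by simpa using he)
  · simp only [Finset.coe_filter, Finset.mem_univ, true_and, Set.mem_ofPred_eq] at he he'
    have hinc := inc_eq_pair hG hwv he.1 he.2
    have hinc' := inc_eq_pair hG hwv he'.1 he'.2
    have hv : f e v = f e' v := by
      rw [← hmv e he, ← hmv e' he']
      exact h.eq (g e) _ (hm e he) _ (hee ▸ hm e' he') u (hg e he).1
        (by rw [hmu' e he, hmu' e' he']) v (hg e he).2
    refine h.edge_eq (P := {v}) (φ := f e)
      (proper_singleton (h.mem e _ (hf e he.1) v he.2)) (hb v)
      (by simpa using hwv) he.1 he'.1 ?_ ?_ (hf e he.1) (hf e' he'.1) ?_ ?_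
      (by rw [hfw e he.1, hfw e' he'.1])
    · simp [hinc]
    · simp [hinc']
    · simp
    · simp [hinc', hv]

/-- If the graph of adjacencies is complete, then all multiplicities are equal. -/
theorem IsBad.mult_eq_of_complete (h : G.IsBad L M) (hb : ∀ v, G.shadow.ConnOn {v}ᶜ)
    (hG : ∀ e, (G.inc e).card = 2) (hcomp : ∀ x y, x ≠ y → G.shadow.Adj x y) {a b x y : V}
    (hab : a ≠ b) (hxy : x ≠ y) : G.mult a b = G.mult x y := by
  have hconn : ∀ A, G.shadow.ConnOn A := by
    rintro A B hB ⟨x, hx⟩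
    refine Finset.Subset.antisymm hB.1 fun y hy => ?_
    by_cases hxy : x = y
    · exact hxy ▸ hx
    · exact hB.2 x hx y hy (hcomp x y hxy)
  have hle : ∀ u v w, u ≠ v → w ≠ v → G.mult w v ≤ G.mult u v := by
    intro u v w huv hwv
    by_cases hwu : w = u
    · rw [hwu]
    · exact h.mult_le hb hG huv hwv (hcomp w u hwu) (hconn _)
  have heq : ∀ u v w, u ≠ v → w ≠ v → G.mult w v = G.mult u v := fun u v w huv hwv =>
    le_antisymm (hle u v w huv hwv) (hle w v u hwv huv)
  by_cases hya : y = a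
  · subst hya
    rw [mult_comm, heq x y b hxy hab.symm]
  · rw [mult_comm, heq y a b hya hab.symm, mult_comm, heq x y a hxy (Ne.symm hya)]

open Classical in
/-- Let `x`, `y` be the neighbours of `w` and `w`, `p` the neighbours of `y`. For each color `c` of
`x`, the remaining colors of `w` all have conflicts with the same `mult w y` colors of `y`. -/
theorem IsBad.exists_conflict (h : G.IsBad L M) (hconn : G.shadow.ConnOn Finset.univ)
    (hb : ∀ v, G.shadow.ConnOn {v}ᶜ) (hG : ∀ e, (G.inc e).card = 2) {x y w p : V} (hxy : x ≠ y)
    (hadj : ¬ G.shadow.Adj x y) (hw : ∀ a, G.shadow.Adj w a ↔ a = x ∨ a = y) (hwp : w ≠ p)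
    (hy : ∀ a, G.shadow.Adj y a ↔ a = w ∨ a = p) {c : W} (hc : c ∈ L x) :
    ∃ A ⊆ L y, G.mult w y ≤ A.card ∧
      ∀ b ∈ L w, ¬ G.Conflict M x w c b → ∀ a ∈ A, G.Conflict M w y b a := by
  have hwx : w ≠ x := ((hw x).2 (Or.inl rfl)).ne
  have hwy : w ≠ y := ((hw y).2 (Or.inr rfl)).ne
  have hpair : G.shadow.ConnOn {x, w}ᶜ := by
    refine SimpleGraph.connOn_of y fun B hB hyB => ?_
    have hBA : ∀ b ∈ B, b ≠ x ∧ b ≠ w := fun b hb => by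
      simpa only [Finset.mem_compl, Finset.mem_insert, Finset.mem_singleton, not_or] using hB.1 hb
    refine (hb x).eq_empty (v := y) ⟨fun b hb => by simpa using (hBA b hb).1,
      fun a ha b hbx hab => hB.2 a ha b ?_ hab⟩ (by simpa using hxy.symm) hyB
    simp only [Finset.mem_compl, Finset.mem_insert, Finset.mem_singleton, not_or] at hbx ⊢
    refine ⟨hbx, ?_⟩
    rintro rfl
    rcases (hw a).1 hab.symm with rfl | rfl
    · exact (hBA a ha).1 rfl
    · exact hyB ha
  obtain ⟨φ, hφ, hφx⟩ := (proper_singleton (φ := fun _ => c) hc).greedy h.toIsCorrespondence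
    h.degree_le (by simp) hpair (B := {y}) (by simp [hxy.symm, hwy.symm])
    (Finset.singleton_nonempty y)
  have hP : ({x} ∪ {x, w}ᶜ \ {y} : Finset V) = {w, y}ᶜ := by
    ext z
    simp only [Finset.mem_union, Finset.mem_singleton, Finset.mem_sdiff, Finset.mem_compl,
      Finset.mem_insert, not_or]
    constructor
    · rintro (rfl | hz)
      · exact ⟨hwx.symm, hxy⟩
      · exact ⟨hz.1.2, hz.2⟩
    · tauto
  rw [hP] at hφ
  -- All vertices but `w` and `y` are colored. The colors of `y` compatible with `p` do not depend
  -- on `w`; one without conflict with an admissible color of `w` would complete the coloring.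
  refine ⟨(L y).filter fun a => ¬ G.Conflict M p y (φ p) a, Finset.filter_subset _ _, ?_, ?_⟩
  · have h1 := Finset.card_filter_add_card_filter_not (s := L y)
      (fun a => G.Conflict M p y (φ p) a)
    have h2 := h.card_conflict_le p y (φ p)
    have h3 := h.card_eq hconn y
    rw [degree_eq_mult_add_mult hG hwp hy, mult_comm y w, mult_comm y p] at h3
    omega
  · intro b hbL hbc a ha
    rw [Finset.mem_filter] at ha
    by_contra hba
    have h1 : G.Proper L M (insert w {w, y}ᶜ) (Function.update φ w b) := by
      refine hφ.update hbL fun e hwe he m hm hmw hmφ => hbc ?_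
      obtain ⟨z, hz, hzw⟩ := G.exists_mem_inc_ne e w
      rcases (hw z).1 ⟨hzw.symm, e, hwe, hz⟩ with rfl | rfl
      · refine ⟨e, hz, hwe, m, hm, ?_, hmw⟩
        rw [hmφ z hz hzw, hφx z (by simp)]
      · have := he hz
        simp [hwy.symm] at this
    have h2 : G.Proper L M (insert y (insert w {w, y}ᶜ))
        (Function.update (Function.update φ w b) y a) := by
      refine h1.update ha.1 fun e hye _ m hm hmy hmφ => ?_
      obtain ⟨z, hz, hzy⟩ := G.exists_mem_inc_ne e y
      have hmz := hmφ z hz hzy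
      rcases (hy z).1 ⟨hzy.symm, e, hye, hz⟩ with rfl | rfl
      · rw [Function.update_self] at hmz
        exact hba ⟨e, hz, hye, m, hm, hmz, hmy⟩
      · rw [Function.update_of_ne hwp.symm] at hmz
        exact ha.2 ⟨e, hz, hye, m, hm, hmz, hmy⟩
    have huniv : insert y (insert w ({w, y}ᶜ : Finset V)) = Finset.univ := by
      ext z
      simp only [Finset.mem_insert, Finset.mem_compl, Finset.mem_singleton, Finset.mem_univ,
        iff_true]
      tauto
    rw [huniv] at h2
    exact h.not_proper _ h2

/-- On a cycle, consecutive multiplicities are equal. -/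
theorem IsBad.mult_le_of_two_neighbors (h : G.IsBad L M) (hconn : G.shadow.ConnOn Finset.univ)
    (hb : ∀ v, G.shadow.ConnOn {v}ᶜ) (hG : ∀ e, (G.inc e).card = 2)
    (hreg : ∀ x y, (L x).card = (L y).card) {x y w p : V} (hxy : x ≠ y)
    (hadj : ¬ G.shadow.Adj x y) (hw : ∀ a, G.shadow.Adj w a ↔ a = x ∨ a = y) (hwp : w ≠ p)
    (hy : ∀ a, G.shadow.Adj y a ↔ a = w ∨ a = p) : G.mult w y ≤ G.mult w x := by
  classical
  by_contra! hlt
  have hd : (L w).card = G.mult w x + G.mult w y := by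
    rw [h.card_eq hconn, degree_eq_mult_add_mult hG hxy hw]
  have hwx := (hw x).2 (Or.inl rfl)
  have hwy := (hw y).2 (Or.inr rfl)
  have hty := mult_pos_of_adj hwy
  have hrest : ∀ c, G.mult w y ≤ ((L w).filter fun b => ¬ G.Conflict M x w c b).card := by
    intro c
    have h1 := Finset.card_filter_add_card_filter_not (s := L w) (fun b => G.Conflict M x w c b)
    have h2 := h.card_conflict_le x w c
    rw [mult_comm] at h2
    omega
  obtain ⟨-, e, hwe, hxe⟩ := hwx
  obtain ⟨c, hc⟩ := h.nonempty hxe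
  obtain ⟨m, hm, hmx⟩ := h.exists_mem (hb x) hxe hc
  have hb' : m w ∈ L w := h.mem e m hm w hwe
  -- The color `m w` is excluded by `c` on `x` but allowed by `c₂`.
  obtain ⟨c₂, hc₂, hcb₂⟩ : ∃ c₂ ∈ L x, ¬ G.Conflict M x w c₂ (m w) := by
    by_contra! hcon
    have h1 := h.card_conflict_le w x (m w)
    rw [Finset.filter_true_of_mem fun c hc => (hcon c hc).symm, hreg x w] at h1
    omega
  obtain ⟨A, hA, hAcard, hAB⟩ := h.exists_conflict hconn hb hG hxy hadj hw hwp hy hc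
  obtain ⟨A₂, hA₂, hAcard₂, hAB₂⟩ := h.exists_conflict hconn hb hG hxy hadj hw hwp hy hc₂
  have h1 := hrest c
  have h2 := hrest c₂
  set B := (L w).filter fun b => ¬ G.Conflict M x w c b with hBdef
  set B₂ := (L w).filter fun b => ¬ G.Conflict M x w c₂ b with hBdef₂
  -- Both sets have at least `mult w y` elements, more than half of `L w`. A common `β` has at most
  -- `mult w y` conflicts at `y`, which forces `A = A₂`.
  obtain ⟨β, hβ⟩ : (B ∩ B₂).Nonempty := by
    rw [← Finset.card_pos]
    have h3 := Finset.card_union_add_card_inter B B₂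
    have h4 : (B ∪ B₂).card ≤ (L w).card := Finset.card_le_card
      (Finset.union_subset (Finset.filter_subset _ _) (Finset.filter_subset _ _))
    omega
  rw [Finset.mem_inter, hBdef, hBdef₂, Finset.mem_filter, Finset.mem_filter] at hβ
  have hN := h.card_conflict_le w y β
  have hAN : A = (L y).filter fun a => G.Conflict M w y β a :=
    Finset.eq_of_subset_of_card_le
      (fun a ha => Finset.mem_filter.2 ⟨hA ha, hAB β hβ.1.1 hβ.1.2 a ha⟩) (by omega)
  have hAN₂ : A₂ = (L y).filter fun a => G.Conflict M w y β a :=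
    Finset.eq_of_subset_of_card_le
      (fun a ha => Finset.mem_filter.2 ⟨hA₂ ha, hAB₂ β hβ.1.1 hβ.2.2 a ha⟩) (by omega)
  obtain ⟨a, ha⟩ := Finset.card_pos.1 (lt_of_lt_of_le hty hAcard)
  have ha₂ : a ∈ A₂ := by rwa [hAN₂, ← hAN]
  -- The color `a ∈ A = A₂` conflicts with all of `B` and with `m w ∉ B`, more than `mult w y`
  -- colors.
  have hsub : insert (m w) B ⊆ (L w).filter fun b => G.Conflict M y w a b := by
    intro b hbB
    rcases Finset.mem_insert.1 hbB with rfl | hbB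
    · exact Finset.mem_filter.2 ⟨hb', (hAB₂ _ hb' hcb₂ a ha₂).symm⟩
    · rw [hBdef, Finset.mem_filter] at hbB
      exact Finset.mem_filter.2 ⟨hbB.1, (hAB b hbB.1 hbB.2 a ha).symm⟩
  have hnot : m w ∉ B := by
    rw [hBdef, Finset.mem_filter]
    exact fun hmB => hmB.2 ⟨e, hxe, hwe, m, hm, hmx, rfl⟩
  have h5 := Finset.card_le_card hsub
  rw [Finset.card_insert_of_notMem hnot] at h5
  have h6 := h.card_conflict_le y w a
  rw [mult_comm] at h6
  omega

/-- The structure of a connected regular hypergraph with an uncolorable correspondence. -/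
theorem IsBad.structure (h : G.IsBad L M) [Nonempty V] (hconn : G.shadow.ConnOn Finset.univ)
    (hreg : ∀ x y, (L x).card = (L y).card) :
    G.IsSingleEdge ∨ ((∀ e, (G.inc e).card = 2) ∧
      (∃ t, 1 ≤ t ∧ ∀ x y, G.shadow.Adj x y → G.mult x y = t) ∧
      ((∀ x y, x ≠ y → G.shadow.Adj x y) ∨
        ∃ n, 3 ≤ n ∧ Nonempty (G.shadow ≃g SimpleGraph.cycleGraph n))) := by
  have hdeg : ∀ x y, G.degree x = G.degree y := fun x y => by
    rw [← h.card_eq hconn, ← h.card_eq hconn, hreg]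
  obtain ⟨z₀⟩ := ‹Nonempty V›
  by_cases h1 : G.degree z₀ = 1
  · exact Or.inl (isSingleEdge_of_degree_eq_one hconn z₀ fun x => (hdeg x z₀).trans h1)
  have hb := h.connOn_compl_singleton hconn hreg
  have hG := h.card_inc hconn hb fun x hx => h1 ((hdeg z₀ x).trans hx)
  refine Or.inr ⟨hG, ?_⟩
  rcases SimpleGraph.complete_or_two_neighbors hconn hb
    fun u v w huv hadj hwu hwv => h.not_connOn_compl_pair hb hG huv hadj hwu hwv with hcomp | hcyc
  · refine ⟨?_, Or.inl hcomp⟩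
    by_cases hex : ∃ a b : V, a ≠ b
    · obtain ⟨a, b, hab⟩ := hex
      exact ⟨G.mult a b, mult_pos_of_adj (hcomp a b hab), fun x y hxy =>
        h.mult_eq_of_complete hb hG hcomp hxy.ne hab⟩
    · push Not at hex
      exact ⟨1, le_rfl, fun x y hxy => absurd (hex x y) hxy.ne⟩
  · have hle : ∀ w x y, x ≠ y → ¬ G.shadow.Adj x y → (∀ a, G.shadow.Adj w a ↔ a = x ∨ a = y) →
        G.mult w y ≤ G.mult w x := by
      intro w x y hxy hadj hw
      have hyw : G.shadow.Adj y w := ((hw y).2 (Or.inr rfl)).symm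
      obtain ⟨p, q, hpq, hpq', hN⟩ := hcyc y
      rcases (hN w).1 hyw with rfl | rfl
      · exact h.mult_le_of_two_neighbors hconn hb hG hreg hxy hadj hw hpq hN
      · exact h.mult_le_of_two_neighbors hconn hb hG hreg hxy hadj hw hpq.symm
          fun a => (hN a).trans or_comm
    have heq : ∀ w a b, G.shadow.Adj w a → G.shadow.Adj w b → G.mult w a = G.mult w b := by
      intro w a b ha hb
      obtain ⟨x, y, hxy, hadj, hw⟩ := hcyc w
      have h2 := le_antisymm (hle w x y hxy hadj hw)
        (hle w y x hxy.symm (fun h => hadj h.symm) fun a => (hw a).trans or_comm)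
      rcases (hw a).1 ha with rfl | rfl <;> rcases (hw b).1 hb with rfl | rfl
      exacts [rfl, h2.symm, h2, rfl]
    obtain ⟨x₀, y₀, -, -, hx₀⟩ := hcyc z₀
    have hz₀ : G.shadow.Adj z₀ x₀ := (hx₀ x₀).2 (Or.inl rfl)
    constructor
    · refine ⟨G.mult z₀ x₀, mult_pos_of_adj hz₀, ?_⟩
      classical
      have hcl : G.shadow.ClosedIn Finset.univ (Finset.univ.filter fun z =>
          ∀ a, G.shadow.Adj z a → G.mult z a = G.mult z₀ x₀) := by
        refine ⟨Finset.subset_univ _, fun z hz b _ hzb => ?_⟩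
        simp only [Finset.mem_filter, Finset.mem_univ, true_and] at hz ⊢
        intro a hba
        rw [heq b a z hba hzb.symm, mult_comm, hz b hzb]
      have hall := hconn _ hcl ⟨z₀, by simpa using fun a ha => heq z₀ a x₀ ha hz₀⟩
      intro x y hxy
      have := hall ▸ Finset.mem_univ x
      simp only [Finset.mem_filter, Finset.mem_univ, true_and] at this
      exact this y hxy
    · have : Nonempty V := ⟨z₀⟩
      refine Or.inr (SimpleGraph.exists_iso_cycleGraph hconn fun z => ?_)
      obtain ⟨x, y, hxy, -, hN⟩ := hcyc z
      exact ⟨x, y, hxy, hN⟩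

end MultiHypergraph

/-! ### Multiples of graphs and covers of the hyperbricks -/

namespace MultiHypergraph

variable {V : Type u} {E : Type v} {V' : Type u'} {E' : Type v'}

/-- A hypergraph with edges of size `2` and constant multiplicity `t` is a multiple of a graph. -/
theorem nonempty_iso_multiple [DecidableEq V] [Fintype E] [DecidableEq V']
    {G : MultiHypergraph V E} {S : SimpleGraph V'} {t : ℕ} (hG : ∀ e, (G.inc e).card = 2)
    (hmult : ∀ x y, G.shadow.Adj x y → G.mult x y = t) (ψ : V ≃ V')
    (hψ : ∀ x y, G.shadow.Adj x y ↔ S.Adj (ψ x) (ψ y)) : Nonempty (G.Iso (multiple t S)) := by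
  classical
  have hex : ∀ e, ∃ s : S.edgeSet, (s : Sym2 V').toFinset = (G.inc e).map ψ.toEmbedding := by
    intro e
    obtain ⟨x, y, hxy, he⟩ := Finset.card_eq_two.1 (hG e)
    refine ⟨⟨s(ψ x, ψ y), (hψ x y).1 ⟨hxy, e, by simp [he], by simp [he]⟩⟩, ?_⟩
    ext z
    simp [he]
  choose f hf using hex
  have hcard : ∀ s : S.edgeSet, Fintype.card {e // f e = s} = t := by
    rintro ⟨s, hs⟩
    induction s with
    | _ a b =>
      have hab : G.shadow.Adj (ψ.symm a) (ψ.symm b) := by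
        rw [hψ]
        simpa using hs
      rw [← hmult _ _ hab, Fintype.card_subtype]
      unfold mult
      congr 1
      ext e
      simp only [Finset.mem_filter, Finset.mem_univ, true_and]
      have hmem : ∀ c, ψ.symm c ∈ G.inc e ↔ c ∈ ((f e : Sym2 V')).toFinset := by
        intro c
        rw [hf, Finset.mem_map_equiv]
      rw [hmem, hmem, Sym2.mem_toFinset, Sym2.mem_toFinset]
      constructor
      · intro h
        simp [h]
      · intro h
        have hne : a ≠ b := S.ne_of_adj hs
        exact Subtype.ext ((Sym2.mem_and_mem_iff hne).1 h)
  refine ⟨ψ, ((Equiv.sigmaFiberEquiv f).symm.trans (Equiv.sigmaCongrRight fun s =>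
    Fintype.equivFinOfCardEq (hcard s))).trans (Equiv.sigmaEquivProd _ _), fun e => ?_⟩
  exact hf e

/-- DP-colorability is invariant under isomorphisms. -/
theorem DPColorable.of_iso {G : MultiHypergraph V E} {G' : MultiHypergraph V' E'}
    (i : G.Iso G') {k : ℕ} (h : G.DPColorable fun _ => k) : G'.DPColorable fun _ => k := by
  intro W F _ _ _ X H hX hcard
  obtain ⟨M, hM, hM', hMu⟩ := hX.matchings
  have hcov : G.IsCover (fun x => X (i.vertexEquiv x)) H := by
    refine ⟨fun x y hxy => hX.disjoint _ _ (i.vertexEquiv.injective.ne hxy), fun w => ?_,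
      fun x => hX.independent _, fun e => M (i.edgeEquiv e), fun e => hM _, fun e f hf => ?_, ?_⟩
    · obtain ⟨x, hx⟩ := hX.union w
      exact ⟨i.vertexEquiv.symm x, by simpa using hx⟩
    · obtain ⟨h1, h2⟩ := hM' _ f hf
      rw [i.inc_edgeEquiv] at h1 h2
      refine ⟨fun w hw => ?_, fun x hx => h2 _ (Finset.mem_map_of_mem _ hx)⟩
      obtain ⟨y, hy, hwy⟩ := Finset.mem_biUnion.1 (h1 hw)
      obtain ⟨x, hx, rfl⟩ := Finset.mem_map.1 hy
      exact Finset.mem_biUnion.2 ⟨x, hx, hwy⟩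
    · rw [← hMu]
      exact i.edgeEquiv.surjective.iUnion_comp M
  obtain ⟨T, hT, hTi⟩ := h W F _ H hcov fun x => hcard _
  exact ⟨T, fun x => by simpa using hT (i.vertexEquiv.symm x), hTi⟩

/-- An upper bound suffices, since for a brick the aim is `maxDegree < k`. -/
theorem maxDegree_le_of_iso [DecidableEq V] [Fintype V] [Fintype E] {n t d : ℕ}
    {S : SimpleGraph (Fin n)} [DecidableRel S.Adj] {G : MultiHypergraph V E}
    (i : G.Iso (multiple t S)) (hd : ∀ x, S.degree x ≤ d) : G.maxDegree ≤ d * t := by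
  refine Finset.sup_le fun x _ => ?_
  calc G.degree x
      ≤ (S.incidenceFinset (i.vertexEquiv x) ×ˢ (Finset.univ : Finset (Fin t))).card := by
        refine Finset.card_le_card_of_injOn
          (fun e => ((((i.edgeEquiv e).1 : S.edgeSet) : Sym2 (Fin n)), (i.edgeEquiv e).2))
          (fun e he => ?_) fun e _ e' _ hee => ?_
        · have hx : i.vertexEquiv x ∈ (multiple t S).inc (i.edgeEquiv e) := by
            rw [i.inc_edgeEquiv]
            exact Finset.mem_map_of_mem _ (by simpa using he)
          have hx' : i.vertexEquiv x ∈ ((i.edgeEquiv e).1 : Sym2 (Fin n)) :=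
            Sym2.mem_toFinset.1 hx
          simp only [Finset.coe_product, Set.mem_prod, Finset.mem_coe,
            SimpleGraph.mem_incidenceFinset, Finset.mem_univ, and_true]
          exact ⟨(i.edgeEquiv e).1.2, hx'⟩
        · simp only [Prod.mk.injEq] at hee
          exact i.edgeEquiv.injective (Prod.ext (Subtype.ext hee.1) hee.2)
    _ = S.degree (i.vertexEquiv x) * t := by
        rw [Finset.card_product, SimpleGraph.card_incidenceFinset_eq_degree, Finset.card_univ,
          Fintype.card_fin]
    _ ≤ d * t := Nat.mul_le_mul_right t (hd _)

/-- A DP-coloring of `tS` with `|R| * t` colors yields a coloring of `S` with colors in `R` for a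
given family of forbidden pairs. -/
theorem DPColorable.exists_coloring {n t k : ℕ} (ht : 1 ≤ t) {S : SimpleGraph (Fin n)} {R : Type}
    [Fintype R] (π : Fin n → Fin n → R → R) (hπ : ∀ u v, Function.Injective (π u v))
    (hk : k ≤ Fintype.card R * t) (h : (multiple t S).DPColorable fun _ => k) :
    ∃ c : Fin n → R, ∀ u v, u < v → S.Adj u v → c v ≠ π u v (c u) := by
  classical
  have : NeZero t := ⟨by omega⟩
  let X : Fin n → Finset (Fin n × R × Fin t) := fun u => Finset.univ.filter fun w => w.1 = u
  -- Each color of `R` becomes a block of `t` colors. Blocks of a forbidden pair are joined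
  -- completely, and this join is split into `t` matchings: the parallel edge with index `s` carries
  -- the shift by `s` in `Fin t`.
  let H : MultiHypergraph (Fin n × R × Fin t)
      ({p : Fin n × Fin n // p.1 < p.2 ∧ S.Adj p.1 p.2} × R × Fin t × Fin t) :=
    { inc := fun f => {(f.1.1.1, f.2.1, f.2.2.1),
        (f.1.1.2, π f.1.1.1 f.1.1.2 f.2.1, f.2.2.1 + f.2.2.2)}
      two_le_card := fun f => by
        rw [Finset.card_pair]
        intro heq
        exact f.1.2.1.ne (congrArg Prod.fst heq) }
  have hmemX : ∀ w u, w ∈ X u ↔ w.1 = u := fun w u => by simp [X]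
  have hinc : ∀ f w, w ∈ H.inc f ↔ w = (f.1.1.1, f.2.1, f.2.2.1) ∨
      w = (f.1.1.2, π f.1.1.1 f.1.1.2 f.2.1, f.2.2.1 + f.2.2.2) := fun f w => by simp [H]
  have hcov : (multiple t S).IsCover X H := by
    refine ⟨fun x y hxy => ?_, fun w => ⟨w.1, by simp [X]⟩, fun x f hf => ?_,
      fun e => {f | s(f.1.1.1, f.1.1.2) = e.1 ∧ f.2.2.2 = e.2}, ?_, ?_, ?_⟩
    · rw [Finset.disjoint_left]
      intro w hx hy
      rw [hmemX] at hx hy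
      exact hxy (hx.symm.trans hy)
    · have h1 := hf ((hinc f _).2 (Or.inl rfl))
      have h2 := hf ((hinc f _).2 (Or.inr rfl))
      rw [hmemX] at h1 h2
      exact f.1.2.1.ne (h1.trans h2.symm)
    · rintro e ⟨⟨⟨u, v⟩, huv, hS⟩, i, a, s⟩ ⟨hfe, hfs⟩ ⟨⟨⟨u', v'⟩, huv', hS'⟩, i', a', s'⟩
        ⟨hfe', hfs'⟩ w hw hw'
      simp only at huv huv' hfe hfs hfe' hfs'
      have huu : u = u' ∧ v = v' := by
        rcases Sym2.eq_iff.1 (hfe.trans hfe'.symm) with h | ⟨rfl, rfl⟩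
        · exact h
        · exact absurd huv huv'.asymm
      obtain ⟨rfl, rfl⟩ := huu
      obtain rfl : s = s' := hfs.trans hfs'.symm
      rw [hinc] at hw hw'
      have hia : i = i' ∧ a = a' := by
        rcases hw with rfl | rfl <;> rcases hw' with hw' | hw' <;>
          simp only [Prod.mk.injEq] at hw'
        · exact hw'.2
        · exact absurd hw'.1 huv.ne
        · exact absurd hw'.1 huv.ne'
        · exact ⟨hπ _ _ hw'.2.1, add_right_cancel hw'.2.2⟩
      obtain ⟨rfl, rfl⟩ := hia
      rfl
    · rintro e ⟨⟨⟨u, v⟩, huv, hS⟩, i, a, s⟩ ⟨hfe, -⟩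
      have hie : ∀ x, x ∈ (multiple t S).inc e ↔ x = u ∨ x = v := by
        intro x
        change x ∈ (e.1 : Sym2 (Fin n)).toFinset ↔ _
        rw [← hfe]
        simp
      constructor
      · intro w hw
        rw [Finset.mem_biUnion]
        refine ⟨w.1, ?_, by simp [X]⟩
        rw [hie]
        rcases (hinc _ _).1 hw with rfl | rfl
        · exact Or.inl rfl
        · exact Or.inr rfl
      · intro x hx
        rw [Finset.card_eq_one]
        rcases (hie x).1 hx with rfl | rfl
        · refine ⟨(x, i, a), ?_⟩
          ext w
          rw [Finset.mem_inter, hinc, hmemX, Finset.mem_singleton]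
          constructor
          · rintro ⟨rfl | rfl, hwx⟩
            · rfl
            · exact absurd hwx huv.ne'
          · rintro rfl
            exact ⟨Or.inl rfl, rfl⟩
        · refine ⟨(x, π u x i, a + s), ?_⟩
          ext w
          rw [Finset.mem_inter, hinc, hmemX, Finset.mem_singleton]
          constructor
          · rintro ⟨rfl | rfl, hwx⟩
            · exact absurd hwx huv.ne
            · rfl
          · rintro rfl
            exact ⟨Or.inr rfl, rfl⟩
    · refine Set.eq_univ_of_forall fun f => Set.mem_iUnion.2 ?_
      exact ⟨(⟨s(f.1.1.1, f.1.1.2), f.1.2.2⟩, f.2.2.2), rfl, rfl⟩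
  have hXcard : ∀ x, k ≤ (X x).card := by
    intro x
    have : X x = (Finset.univ : Finset (R × Fin t)).map
        ⟨fun p => (x, p), fun p q hpq => (Prod.ext_iff.1 hpq).2⟩ := by
      ext w
      rw [hmemX, Finset.mem_map]
      constructor
      · rintro rfl
        exact ⟨w.2, Finset.mem_univ _, rfl⟩
      · rintro ⟨p, -, rfl⟩
        rfl
    rw [this, Finset.card_map, Finset.card_univ, Fintype.card_prod, Fintype.card_fin]
    exact hk
  obtain ⟨T, hT, hTi⟩ := h _ _ X H hcov hXcard
  have hw : ∀ x, ∃ w ∈ T, w.1 = x := by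
    intro x
    obtain ⟨w, hw⟩ := Finset.card_pos.1 (show 0 < (T ∩ X x).card by rw [hT]; exact one_pos)
    rw [Finset.mem_inter, hmemX] at hw
    exact ⟨w, hw⟩
  choose w hwT hwx using hw
  refine ⟨fun x => (w x).2.1, fun u v huv hS heq => ?_⟩
  refine hTi (⟨(u, v), huv, hS⟩, (w u).2.1, (w u).2.2, (w v).2.2 - (w u).2.2) fun z hz => ?_
  rcases (hinc _ _).1 hz with rfl | rfl
  · have : ((u, (w u).2.1, (w u).2.2) : Fin n × R × Fin t) = w u := Prod.ext (hwx u).symm rfl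
    exact (congrArg (· ∈ T) this).mpr (hwT u)
  · have : ((v, π u v (w u).2.1, (w u).2.2 + ((w v).2.2 - (w u).2.2)) : Fin n × R × Fin t) =
        w v := Prod.ext (hwx v).symm (Prod.ext heq.symm (add_sub_cancel _ _))
    exact (congrArg (· ∈ T) this).mpr (hwT v)

/-- Identity permutations ask for an ordinary coloring of `K_n` with `n - 1` colors. -/
theorem lt_of_dpColorable_complete {n t k : ℕ} (ht : 1 ≤ t) (hn : 1 ≤ n)
    (h : (multiple t (SimpleGraph.completeGraph (Fin n))).DPColorable fun _ => k) :
    (n - 1) * t < k := by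
  by_contra! hk
  obtain ⟨c, hc⟩ := h.exists_coloring ht (R := Fin (n - 1)) (fun _ _ => id)
    (fun _ _ => Function.injective_id) (by simpa using hk)
  have hinj : Function.Injective c := by
    intro u v huv
    by_contra hne
    rcases lt_or_gt_of_ne hne with hlt | hlt
    · exact hc u v hlt hne huv.symm
    · exact hc v u hlt (Ne.symm hne) huv
  have := Fintype.card_le_of_injective c hinj
  simp only [Fintype.card_fin] at this
  omega

/-- With two colors, the negations along the path force equal colors, while the identity on the
closing edge asks its ends to differ. This works for either parity of `n`. -/
theorem lt_of_dpColorable_cycle {n t k : ℕ} (ht : 1 ≤ t) (hn : 3 ≤ n)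
    (h : (multiple t (SimpleGraph.cycleGraph n)).DPColorable fun _ => k) : 2 * t < k := by
  by_contra! hk
  obtain ⟨m, rfl⟩ : ∃ m, n = m + 3 := ⟨n - 3, by omega⟩
  obtain ⟨c, hc⟩ := h.exists_coloring ht (R := Bool)
    (fun u v b => if u = 0 ∧ v = Fin.last (m + 2) then b else !b)
    (fun u v => by
      split_ifs
      · exact Function.injective_id
      · exact Bool.not_injective) (by simpa using hk)
  have hconst : ∀ j, c j = c 0 := by
    intro j
    induction j using Fin.induction with
    | zero => rfl
    | succ j ih =>
      have h1 := hc j.castSucc j.succ Fin.castSucc_lt_succ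
        (by
          rw [SimpleGraph.cycleGraph_adj]
          right
          rw [← Fin.coeSucc_eq_succ]
          exact add_sub_cancel_left _ _)
      rw [if_neg] at h1
      · rw [← ih]
        simpa using h1
      · rintro ⟨h2, h3⟩
        have h2' : (j : ℕ) = 0 := congrArg Fin.val h2
        have h3' : (j : ℕ) + 1 = m + 2 := congrArg Fin.val h3
        omega
  have h1 := hc 0 (Fin.last (m + 2)) (Fin.last_pos) (by
    rw [SimpleGraph.cycleGraph_adj]
    left
    exact sub_eq_of_eq_add' (Fin.last_add_one _).symm)
  rw [if_pos ⟨rfl, rfl⟩] at h1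
  exact h1 (hconst _)

/-- With lists of size one, the only transversal is the whole vertex set of the cover, which can be
made an edge. -/
theorem lt_of_dpColorable_singleEdge [Fintype V] {G : MultiHypergraph V E} {k : ℕ}
    (hG : G.IsSingleEdge) (h : G.DPColorable fun _ => k) : 1 < k := by
  classical
  by_contra! hk
  obtain ⟨e, he, hV⟩ := hG
  have huniv : G.inc e = Finset.univ := Finset.eq_univ_of_forall hV
  have hcard : 2 ≤ Fintype.card V := by
    have := G.two_le_card e
    rwa [huniv] at this
  let ψ := Fintype.equivFin V
  let X : V → Finset (Fin (Fintype.card V)) := fun x => {ψ x}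
  let H : MultiHypergraph (Fin (Fintype.card V)) Unit :=
    { inc := fun _ => Finset.univ
      two_le_card := fun _ => by
        rw [Finset.card_univ, Fintype.card_fin]
        exact hcard }
  have hcov : G.IsCover X H := by
    refine ⟨fun x y hxy => ?_, fun w => ⟨ψ.symm w, by simp [X]⟩, fun x f hf => ?_,
      fun _ => Set.univ, fun _ f _ f' _ _ _ _ => rfl, fun e' f _ => ⟨fun w _ => ?_, fun x _ => ?_⟩,
      ?_⟩
    · simpa [X] using hxy
    · have := Finset.card_le_card hf
      simp [X, H] at this
      omega
    · rw [Finset.mem_biUnion]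
      exact ⟨ψ.symm w, he e' ▸ hV _, by simp [X]⟩
    · simp [X, H]
    · have : Nonempty E := ⟨e⟩
      exact Set.iUnion_const _
  obtain ⟨T, hT, hTi⟩ := h _ _ X H hcov fun x => by simpa [X] using hk
  refine hTi () fun w _ => ?_
  obtain ⟨z, hz⟩ := Finset.card_pos.1
    (show 0 < (T ∩ X (ψ.symm w)).card by rw [hT]; exact one_pos)
  simp only [X, Finset.mem_inter, Finset.mem_singleton, Equiv.apply_symm_apply] at hz
  exact hz.2 ▸ hz.1

theorem IsDPHyperbrick.maxDegree_lt [Fintype V] [DecidableEq V] [Fintype E]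
    {G : MultiHypergraph V E} (hG : G.IsDPHyperbrick) {k : ℕ} (h : G.DPColorable fun _ => k) :
    G.maxDegree < k := by
  classical
  rcases hG with (⟨t, n, ht, hn, ⟨i⟩⟩ | ⟨t, n, ht, hn, ⟨i⟩⟩) | hG
  · refine (maxDegree_le_of_iso i (d := n - 1) fun x => ?_).trans_lt
      (lt_of_dpColorable_complete ht hn (h.of_iso i))
    have := SimpleGraph.degree_lt_card_verts (G := SimpleGraph.completeGraph (Fin n)) x
    rw [Fintype.card_fin] at this
    omega
  · refine (maxDegree_le_of_iso i (d := 2) fun x => ?_).trans_lt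
      (lt_of_dpColorable_cycle ht hn (h.of_iso i))
    obtain ⟨m, rfl⟩ : ∃ m, n = m + 3 := ⟨n - 3, by omega⟩
    exact SimpleGraph.cycleGraph_degree_three_le.le
  · refine lt_of_le_of_lt ?_ (lt_of_dpColorable_singleEdge hG h)
    obtain ⟨e, he, -⟩ := hG
    refine Finset.sup_le fun x _ => Finset.card_le_one.2 fun a _ b _ => ?_
    rw [he a, he b]

/-! ### From covers to correspondences, and the theorem -/

open Classical in
/-- The correspondence of a cover without independent transversal has no proper coloring. -/
theorem IsCover.exists_correspondence [Fintype V] [DecidableEq V]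
    {G : MultiHypergraph V E} {W : Type u'} {F : Type v'} [DecidableEq W] {X : V → Finset W}
    {H : MultiHypergraph W F} (hX : G.IsCover X H) (hbad : ¬ HasIndependentTransversal X H) :
    ∃ M : E → Set (V → W), G.IsCorrespondence X M ∧
      ∀ φ, ¬ G.Proper X M Finset.univ φ := by
  obtain ⟨M, hM, hM', hMu⟩ := hX.matchings
  refine ⟨fun e => {m | ∃ f ∈ M e, ∀ x ∈ G.inc e, m x ∈ H.inc f ∩ X x}, ⟨?_, ?_⟩, ?_⟩
  · rintro e m ⟨f, hf, hm⟩ x hx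
    exact (Finset.mem_inter.1 (hm x hx)).2
  · rintro e m ⟨f, hf, hm⟩ m' ⟨f', hf', hm'⟩ x hx heq y hy
    have hff : f = f' := hM e f hf f' hf' (m x) (Finset.mem_inter.1 (hm x hx)).1
      (heq ▸ (Finset.mem_inter.1 (hm' x hx)).1)
    subst hff
    exact Finset.card_le_one.1 ((hM' e f hf).2 y hy).le _ (hm y hy) _ (hm' y hy)
  · intro φ hφ
    have huniq : ∀ x y, φ x ∈ X y → x = y := by
      intro x y hxy
      by_contra hne
      exact Finset.disjoint_left.1 (hX.disjoint x y hne) (hφ.1 x (Finset.mem_univ x)) hxy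
    refine hbad ⟨Finset.univ.image φ, fun x => ?_, fun f hf => ?_⟩
    · rw [Finset.card_eq_one]
      refine ⟨φ x, ?_⟩
      ext w
      simp only [Finset.mem_inter, Finset.mem_image, Finset.mem_univ, true_and,
        Finset.mem_singleton]
      constructor
      · rintro ⟨⟨y, rfl⟩, hy⟩
        rw [huniq y x hy]
      · rintro rfl
        exact ⟨⟨x, rfl⟩, hφ.1 x (Finset.mem_univ x)⟩
    · obtain ⟨e, he⟩ := Set.mem_iUnion.1 (hMu ▸ Set.mem_univ f)
      -- If the image of `φ` contains the edge `f`, then `φ` itself is a forbidden pattern of `e`.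
      obtain ⟨x, hx, hne⟩ := hφ.2 e (Finset.subset_univ _) φ ⟨f, he, fun x hx => by
        obtain ⟨w, hw⟩ := Finset.card_pos.1
          (show 0 < (H.inc f ∩ X x).card by rw [(hM' e f he).2 x hx]; exact one_pos)
        obtain ⟨y, -, rfl⟩ := Finset.mem_image.1 (hf (Finset.mem_inter.1 hw).1)
        rwa [huniq y x (Finset.mem_inter.1 hw).2] at hw⟩
      exact hne rfl

variable [Fintype V] [DecidableEq V] [Fintype E] {G : MultiHypergraph V E}

theorem degree_le_maxDegree (x : V) : G.degree x ≤ G.maxDegree :=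
  Finset.le_sup (f := G.degree) (Finset.mem_univ x)

theorem dpColorable_maxDegree_add_one (hG : G.shadow.ConnOn Finset.univ) :
    G.DPColorable fun _ => G.maxDegree + 1 := by
  intro W F _ _ _ X H hX hcard
  by_contra hbad
  obtain ⟨M, hM, hM'⟩ := hX.exists_correspondence hbad
  have hB : G.IsBad X M := ⟨hM, fun x =>
    (degree_le_maxDegree x).trans ((Nat.le_succ _).trans (hcard x)), hM'⟩
  rcases isEmpty_or_nonempty V with hV | ⟨⟨x⟩⟩
  · exact hM' (fun x => hV.elim x) (by rw [Finset.univ_eq_empty]; exact proper_empty _)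
  · have h1 := hB.card_eq hG x
    have h2 := degree_le_maxDegree (G := G) x
    have h3 : G.maxDegree + 1 ≤ (X x).card := hcard x
    omega

/-- In a bad cover, `Δ ≤ |X x| = degree x ≤ Δ` makes all lists equally large, so `IsBad.structure`
applies. -/
theorem dpColorable_maxDegree (hG : G.shadow.ConnOn Finset.univ) (hbrick : ¬ G.IsDPHyperbrick) :
    G.DPColorable fun _ => G.maxDegree := by
  intro W F _ _ _ X H hX hcard
  by_contra hbad
  obtain ⟨M, hM, hM'⟩ := hX.exists_correspondence hbad
  have hB : G.IsBad X M := ⟨hM, fun x => (degree_le_maxDegree x).trans (hcard x), hM'⟩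
  rcases isEmpty_or_nonempty V with hV | hV
  · exact hM' (fun x => hV.elim x) (by rw [Finset.univ_eq_empty]; exact proper_empty _)
  have hreg : ∀ x, (X x).card = G.maxDegree := fun x =>
    le_antisymm ((hB.card_eq hG x).le.trans (degree_le_maxDegree x)) (hcard x)
  refine hbrick ?_
  rcases hB.structure hG (fun x y => (hreg x).trans (hreg y).symm) with
    h | ⟨h2, ⟨t, ht, hmult⟩, hcomp | ⟨n, hn, ⟨i⟩⟩⟩
  · exact Or.inr h
  · refine Or.inl (Or.inl ⟨t, Fintype.card V, ht, Fintype.card_pos, ?_⟩)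
    refine nonempty_iso_multiple h2 hmult (Fintype.equivFin V) fun x y => ?_
    exact ⟨fun h => (Fintype.equivFin V).injective.ne h.ne,
      fun h => hcomp x y fun hxy => h (congrArg _ hxy)⟩
  · exact Or.inl (Or.inr ⟨t, n, ht, hn,
      nonempty_iso_multiple h2 hmult i.toEquiv fun x y => i.map_adj_iff.symm⟩)

end MultiHypergraph

theorem mainTheorem4 {V : Type*} {E : Type*} [Fintype V] [DecidableEq V] [Fintype E]
    (G : MultiHypergraph V E) (hG : G.Connected) :
    G.dpChromaticNumber ≤ (G.maxDegree : ℕ∞) + 1 ∧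
      (G.dpChromaticNumber = (G.maxDegree : ℕ∞) + 1 ↔ G.IsDPHyperbrick) := by
  have hle : ∀ k, (G.DPColorable fun _ => k) → G.dpChromaticNumber ≤ (k : ℕ∞) :=
    fun k hk => iInf₂_le k hk
  have h1 : G.dpChromaticNumber ≤ (G.maxDegree : ℕ∞) + 1 := by
    exact_mod_cast hle _ (MultiHypergraph.dpColorable_maxDegree_add_one hG.connOn)
  refine ⟨h1, fun h => ?_, fun h => le_antisymm h1 (le_iInf₂ fun k hk => ?_)⟩
  · by_contra hbrick
    have h2 := hle _ (MultiHypergraph.dpColorable_maxDegree hG.connOn hbrick)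
    rw [h] at h2
    have h3 : G.maxDegree + 1 ≤ G.maxDegree := by exact_mod_cast h2
    omega
  · exact_mod_cast Nat.succ_le_of_lt (h.maxDegree_lt hk)
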